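/- There is an absolute constant $C$ such that the following holds. Let $\mathcal F$ be a family of finite connected graphs whose maximum degree $d=\Delta(\mathcal F)=\sup_{F\in\mathcal F}\Delta(F)$ is finite (with $\Delta(\emptyset)=0$). In the problem $\mathcal F$-Minor Deletion parameterized by vertex cover size $K$, an instance consists of a graph $G$ on the vertex set $\{0,\dots,n-1\}$ and integers $k,K\ge 0$ such that $G$ has a vertex cover of size at most $K$ and $d\le K$; the question is whether there is a set $X\subseteq V(G)$ with $|X|\le k$ such that no $F\in\mathcal F$ is a minor of $G\setminus X$. The graph is given in the Adjacency List (AL) model: the vertices are exposed one after another in an arbitrary order, and when a vertex $v$ is exposed, all edges incident to $v$ are revealed one by one in an arbitrary order (so every edge appears twice in the stream). The numbers $n,k,K$ are known in advance. Then $\mathcal F$-Minor Deletion is $(\mathrm{AL},\,O(d\cdot K^{d+1}))$-streamable, by a deterministic algorithm: there is a one-pass deterministic streaming algorithm, one for all $n,k,K$, which for every such instance and every AL stream of it answers correctly and at every moment of the stream (before the first, between any two, and after the last element) stores at most $C\cdot d\cdot K^{d+1}$ words, where a word has $\lfloor\log_2 n\rfloor+1$ bits. Moreover, if membership in $\mathcal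 F$ is decidable (for example, if $\mathcal F$ is finite), then the initialization, update and output functions of the algorithm are computable. -/

import Mathlib

/-! ## Minors, and the vertex-deletion problem -/

/-- `F` is a minor of `G`: there are pairwise disjoint, connected (in particular nonempty) branch
sets in `G`, one for each vertex of `F`, such that adjacent vertices of `F` have branch sets that
are joined by an edge of `G`. -/
def IsMinor {W V : Type*} (F : SimpleGraph W) (G : SimpleGraph V) : Prop :=
  ∃ B : W → Set V,
    (∀ a, (G.induce (B a)).Connected) ∧
    (∀ a b, a ≠ b → Disjoint (B a) (B b)) ∧
    (∀ a b, F.Adj a b → ∃ x ∈ B a, ∃ y ∈ B b, G.Adj x y)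

/-- A finite graph, with vertex set `Fin m` for some `m`. -/
abbrev FinGraph : Type := Σ m : ℕ, SimpleGraph (Fin m)

open Classical in
/-- `Δ(𝓕)`, the supremum of the maximum degrees of the members of `𝓕` (`⊤` if unbounded). -/
noncomputable def familyMaxDegree (𝓕 : Set FinGraph) : ℕ∞ :=
  ⨆ F ∈ 𝓕, (F.2.maxDegree : ℕ∞)

/-- The finite graph on `m` vertices that is described by a list of (unordered) edges. -/
def graphOfCode (c : ℕ × List (ℕ × ℕ)) : FinGraph :=
  ⟨c.1, SimpleGraph.fromRel fun i j : Fin c.1 => ((i : ℕ), (j : ℕ)) ∈ c.2⟩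

/-- Membership in the family `𝓕` is algorithmically decidable, for graphs given by edge lists. -/
def FamilyDecidable (𝓕 : Set FinGraph) : Prop :=
  ComputablePred fun c : ℕ × List (ℕ × ℕ) => graphOfCode c ∈ 𝓕

/-- A graph decision problem. An instance is a graph `G` on the vertex set `Fin n`, a number `k`
(size of the solution) and a number `K` (the parameter). `Promise` singles out the legal instances
and `Yes` the positive ones. -/
structure ParamGraphProblem where
  Promise : (n k K : ℕ) → SimpleGraph (Fin n) → Prop
  Yes : (n k K : ℕ) → SimpleGraph (Fin n) → Prop

/-- `𝓕`-Minor Deletion, parameterized by vertex cover size `K`: is there a set `X` of at most `k`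
vertices such that `G ∖ X` has no member of `𝓕` as a minor? The legal instances are those with
`VC(G) ≤ K` and `Δ(𝓕) ≤ K`. -/
noncomputable def minorDeletion (𝓕 : Set FinGraph) : ParamGraphProblem where
  Promise _ _ K G := G.vertexCoverNum ≤ (K : ℕ∞) ∧ familyMaxDegree 𝓕 ≤ (K : ℕ∞)
  Yes n k _ G := ∃ X : Finset (Fin n), X.card ≤ k ∧
    ∀ F ∈ 𝓕, ¬ IsMinor F.2 (G.induce {v | v ∉ X})

/-! ## The Adjacency List model -/

/-- An element of the stream: `Sum.inl v` announces that the vertex `v` is exposed, and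
`Sum.inr (v, w)` reveals the edge between the exposed vertex `v` and its neighbour `w`. -/
abbrev ALToken : Type := ℕ ⊕ (ℕ × ℕ)

/-- `σ` is an Adjacency List stream of `G`: the vertices are exposed in some order, each exactly
once, and upon the exposure of `v` all the edges incident to `v` are revealed one by one in some
order. -/
def IsALStream {n : ℕ} (G : SimpleGraph (Fin n)) (σ : List ALToken) : Prop :=
  ∃ (order : List (Fin n)) (nbr : Fin n → List (Fin n)),
    order.Nodup ∧ (∀ v, v ∈ order) ∧
    (∀ v, (nbr v).Nodup ∧ ∀ w, w ∈ nbr v ↔ G.Adj v w) ∧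
    σ = order.flatMap fun v : Fin n =>
      (Sum.inl (v : ℕ) : ALToken) :: (nbr v).map fun w : Fin n => Sum.inr ((v : ℕ), (w : ℕ))

/-! ## Streaming algorithms -/

/-- The numbers `(n, k, K)` that an algorithm knows in advance. -/
abbrev Params : Type := ℕ × ℕ × ℕ

/-- A one-pass (randomized) streaming algorithm, uniform in `(n, k, K)`. All that it remembers
between two elements of the stream is its memory, a list of words. When an element arrives, the
memory is updated, depending on the element and on `coins` many fresh fair coin flips, given as
a number below `2 ^ coins`. After the stream has ended the answer is computed from the memory. -/
structure StreamingAlgorithm where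
  coins : Params → ℕ
  init : Params → List ℕ
  step : Params → List ℕ → ALToken → ℕ → List ℕ
  output : Params → List ℕ → Bool

namespace StreamingAlgorithm

/-- The algorithm flips no coins. -/
def IsDeterministic (A : StreamingAlgorithm) : Prop :=
  ∀ p, A.coins p = 0

/-- All parts of the algorithm are computable functions. -/
def IsComputable (A : StreamingAlgorithm) : Prop :=
  Computable A.coins ∧ Computable A.init ∧
  (Computable fun x : Params × List ℕ × ALToken × ℕ => A.step x.1 x.2.1 x.2.2.1 x.2.2.2) ∧
  (Computable fun x : Params × List ℕ => A.output x.1 x.2)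

/-- The outcomes of all coin flips during a stream of length `L`. -/
abbrev CoinSeq (A : StreamingAlgorithm) (p : Params) (L : ℕ) : Type :=
  Fin L → Fin (2 ^ A.coins p)

/-- The memory after the first `i` elements of the stream `σ`, for the coin flips `r`. -/
def memory (A : StreamingAlgorithm) (p : Params) (σ : List ALToken)
    (r : A.CoinSeq p σ.length) (i : ℕ) : List ℕ :=
  ((List.finRange σ.length).take i).foldl
    (fun s j => A.step p s (σ.get j) (r j)) (A.init p)

/-- The memory `s` consists of at most `S` words, each of `⌊log₂ n⌋ + 1` bits. -/
def FitsInWords (n S : ℕ) (s : List ℕ) : Prop :=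
  s.length ≤ S ∧ ∀ w ∈ s, w < 2 ^ (Nat.log 2 n + 1)

/-- The algorithm solves `P` in the Adjacency List model with `S n K` words of memory: for every
legal instance and every stream of it, the space bound holds at all times and for all coin flips,
and the answer is correct with probability at least `2/3` over uniformly random coin flips. -/
def SolvesInAL (A : StreamingAlgorithm) (P : ParamGraphProblem) (S : ℕ → ℕ → ℕ) : Prop :=
  ∀ (n k K : ℕ) (G : SimpleGraph (Fin n)), P.Promise n k K G →
    ∀ σ : List ALToken, IsALStream G σ →
      (∀ (r : A.CoinSeq (n, k, K) σ.length) (i : ℕ), i ≤ σ.length →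
        FitsInWords n (S n K) (A.memory (n, k, K) σ r i)) ∧
      (2 / 3 : ℝ) ≤
        (Nat.card {r : A.CoinSeq (n, k, K) σ.length //
            A.output (n, k, K) (A.memory (n, k, K) σ r σ.length) = true ↔ P.Yes n k K G} : ℝ) /
          (Nat.card (A.CoinSeq (n, k, K) σ.length) : ℝ)

end StreamingAlgorithm

/-! The algorithm grows a matching greedily. Each matching edge uses its own vertex of a vertex
cover of size at most `K`, so the set `M` of matched vertices has size at most `2K`. In the end the
unmatched vertices are independent. All edges inside `M` are stored. When an unmatched vertex `v`
has been exposed, all its neighbours lie in `M`, and its edges to `S` are kept for every `S ⊆ N(v)`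
with `|S| ≤ d` that has fewer than `N = K + 2dK` recorded common neighbours.

Why nothing is lost: in a minor model of `F`, a vertex of the branch set of `a` needs only one edge
per `F`-neighbour of `a`, so an edge-minimal subgraph `H` carrying the model has maximum degree at
most `d` (`MinorIn.exists_le_degree_le`). Let `H` avoid a deleted set `X` with `|X| < K`, and
suppose that `H` uses a discarded edge at an unmatched vertex `v`. The `H`-neighbours of `v` form a
subset of `M` of size at most `d`, so they have at least `N` stored common neighbours. At most `|X|`
of these lie in `X`, and at most `|M|·d ≤ 2Kd` are non-isolated in `H`; hence one is free and can
take over the role of `v`. Iterating this exchange moves `H` into the stored graph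
(`MinorIn.transfer`). If `k ≥ K`, deleting a vertex cover destroys all edges and the answer is yes;
otherwise `|X| ≤ k < K` as needed.

Space: at most `N` vertices are ever charged to a given `S`, so the total is governed by `N · ∑ |S|`
over the subsets of `M` of size at most `d`. This is `O(d · K^(d+1))` with an absolute constant,
because the exponential series bounds the sum by `81 · K^d`. `Invariant` holds what must survive
each stream element.

The output is found by brute force over all `X` and all minors of the stored graph. Families that
are empty or contain the one-vertex graph need no memory and are treated apart; for all others `d ≥
1`. -/

/-! ### Minor models within a vertex set, and subgraphs of small degree that carry them. -/

namespace SimpleGraph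

variable {V W : Type*}

/-- `F` is a minor of `G`, with all branch sets contained in `s`. -/
def MinorIn (F : SimpleGraph W) (G : SimpleGraph V) (s : Set V) : Prop :=
  ∃ B : W → Set V,
    (∀ a, B a ⊆ s) ∧
    (∀ a, (G.induce (B a)).Connected) ∧
    (∀ a b, a ≠ b → Disjoint (B a) (B b)) ∧
    (∀ a b, F.Adj a b → ∃ x ∈ B a, ∃ y ∈ B b, G.Adj x y)

/-- An induced subgraph of an induced subgraph. -/
noncomputable def induceInduceIso (G : SimpleGraph V) (s : Set V) (t : Set s) :
    (G.induce s).induce t ≃g G.induce (Subtype.val '' t) where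
  toEquiv := Equiv.Set.image _ t Subtype.val_injective
  map_rel_iff' := by
    rintro ⟨a, ha⟩ ⟨b, hb⟩
    rfl

/-- Branch sets become sets of ambient vertices, so that the graph can be modified while the deleted
set stays fixed. -/
theorem isMinor_induce_iff {F : SimpleGraph W} {G : SimpleGraph V} {s : Set V} :
    IsMinor F (G.induce s) ↔ MinorIn F G s := by
  constructor
  · rintro ⟨B, hc, hd, ha⟩
    refine ⟨fun a => Subtype.val '' B a, ?_, ?_, ?_, ?_⟩
    · rintro a _ ⟨x, -, rfl⟩
      exact x.2
    · intro a
      exact ((induceInduceIso G s (B a)).connected_iff).1 (hc a)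
    · intro a b hab
      exact (Set.disjoint_image_iff Subtype.val_injective).2 (hd a b hab)
    · intro a b hab
      obtain ⟨x, hx, y, hy, h⟩ := ha a b hab
      exact ⟨x, ⟨x, hx, rfl⟩, y, ⟨y, hy, rfl⟩, h⟩
  · rintro ⟨B, hs, hc, hd, ha⟩
    have hB : ∀ a, Subtype.val '' (Subtype.val ⁻¹' B a : Set s) = B a := by
      intro a
      rw [Subtype.image_preimage_coe]
      exact Set.inter_eq_right.2 (hs a)
    refine ⟨fun a => Subtype.val ⁻¹' B a, ?_, ?_, ?_⟩
    · intro a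
      rw [(induceInduceIso G s _).connected_iff, hB]
      exact hc a
    · intro a b hab
      exact (hd a b hab).preimage _
    · intro a b hab
      obtain ⟨x, hx, y, hy, h⟩ := ha a b hab
      exact ⟨⟨x, hs a hx⟩, hx, ⟨y, hs b hy⟩, hy, h⟩

theorem MinorIn.mono {F : SimpleGraph W} {G G' : SimpleGraph V} {s t : Set V}
    (h : MinorIn F G s) (hG : G ≤ G') (hst : s ⊆ t) : MinorIn F G' t := by
  obtain ⟨B, hs, hc, hd, ha⟩ := h
  refine ⟨B, fun a => (hs a).trans hst, fun a => (hc a).mono ?_, hd, fun a b hab => ?_⟩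
  · exact comap_monotone _ hG
  · obtain ⟨x, hx, y, hy, h⟩ := ha a b hab
    exact ⟨x, hx, y, hy, hG h⟩

/-- The branch sets of a minor model of a connected nontrivial graph contain no isolated
vertices. -/
theorem MinorIn.support [Nontrivial W] {F : SimpleGraph W} {H : SimpleGraph V} {s : Set V}
    (hF : F.Connected) (h : MinorIn F H s) : MinorIn F H H.support := by
  obtain ⟨B, hs, hc, hd, ha⟩ := h
  refine ⟨B, fun a x hx => ?_, hc, hd, ha⟩
  by_cases hn : (B a).Nontrivial
  · have : Nontrivial (B a) := hn.coe_sort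
    obtain ⟨y, hy⟩ := (hc a).preconnected.exists_adj_of_nontrivial ⟨x, hx⟩
    exact ⟨y, hy⟩
  · obtain ⟨b, hb⟩ := hF.preconnected.exists_adj_of_nontrivial a
    obtain ⟨x', hx', y, hy, h⟩ := ha a b hb
    rw [Set.not_nontrivial_iff.1 hn hx hx']
    exact ⟨y, h⟩

/-- `G` with the edges at `v` restricted to those leading to `S`. -/
def restrictAt (G : SimpleGraph V) (v : V) (S : Set V) : SimpleGraph V where
  Adj x y := G.Adj x y ∧ (x = v → y ∈ S) ∧ (y = v → x ∈ S)
  symm := ⟨fun _ _ h => ⟨h.1.symm, h.2.2, h.2.1⟩⟩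
  loopless := ⟨fun _ h => h.1.ne rfl⟩

theorem restrictAt_le (G : SimpleGraph V) (v : V) (S : Set V) : G.restrictAt v S ≤ G :=
  fun _ _ h => h.1

theorem connected_induce_restrictAt {G : SimpleGraph V} {v : V} {S B : Set V} (hv : v ∉ B)
    (h : (G.induce B).Connected) : ((G.restrictAt v S).induce B).Connected := by
  refine h.mono ?_
  rintro ⟨x, hx⟩ ⟨y, hy⟩ hxy
  exact ⟨hxy, fun e => absurd (e ▸ hx) hv, fun e => absurd (e ▸ hy) hv⟩

/-- From a vertex `v` of a connected set `B`, a vertex `x` of `B` can be reached so that only one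
edge at `v` is used. -/
theorem exists_step_reachable {G : SimpleGraph V} {v x : V} {B : Set V}
    (h : (G.induce B).Connected) (hv : v ∈ B) (hx : x ∈ B) (hne : x ≠ v) :
    ∃ w, G.Adj v w ∧ ∀ S : Set V, w ∈ S →
      ((G.restrictAt v S).induce B).Reachable ⟨v, hv⟩ ⟨x, hx⟩ := by
  obtain ⟨p, hp⟩ := h.exists_isPath ⟨v, hv⟩ ⟨x, hx⟩
  cases p with
  | nil => exact absurd rfl hne
  | @cons _ w _ hw q =>
    rw [Walk.cons_isPath_iff] at hp
    refine ⟨w, hw, fun S hS => ?_⟩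
    have h1 : ((G.restrictAt v S).induce B).Adj ⟨v, hv⟩ w := by
      refine ⟨hw, fun _ => hS, fun e => ?_⟩
      exact absurd e (G.ne_of_adj hw).symm
    -- The rest `q` of the path never returns to `v`, so none of its edges is affected by the
    -- restriction at `v`.
    refine h1.reachable.trans ⟨q.transfer _ ?_⟩
    rintro ⟨a, b⟩ he
    have ha := q.fst_mem_support_of_mem_edges he
    have hb := q.snd_mem_support_of_mem_edges he
    have hab := q.adj_of_mem_edges he
    refine ⟨hab, fun e => absurd ?_ hp.2, fun e => absurd ?_ hp.2⟩
    · rwa [show (⟨v, hv⟩ : B) = a from Subtype.ext e.symm]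
    · rwa [show (⟨v, hv⟩ : B) = b from Subtype.ext e.symm]

/-- Only few of the edges at a given vertex are needed in a minor model. -/
theorem MinorIn.exists_restrictAt [Finite W] {F : SimpleGraph W} {G : SimpleGraph V} {s : Set V}
    {d : ℕ} (hdeg : ∀ a, (F.neighborSet a).ncard ≤ d) (h : MinorIn F G s) (v : V) :
    ∃ S : Set V, S.Finite ∧ S.ncard ≤ d ∧ MinorIn F (G.restrictAt v S) s := by
  classical
  obtain ⟨B, hs, hc, hd, ha⟩ := h
  by_cases hv : ∃ a, v ∈ B a
  swap
  · push Not at hv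
    refine ⟨∅, Set.finite_empty, by simp, B, hs, fun a => connected_induce_restrictAt (hv a) (hc a),
      hd, fun a b hab => ?_⟩
    obtain ⟨x, hx, y, hy, h⟩ := ha a b hab
    exact ⟨x, hx, y, hy, h, fun e => absurd (e ▸ hx) (hv a), fun e => absurd (e ▸ hy) (hv b)⟩
  obtain ⟨a, hva⟩ := hv
  have hvb : ∀ b, b ≠ a → v ∉ B b := fun b hb h => Set.disjoint_left.1 (hd b a hb) h hva
  -- One edge `v w` is reserved per `F`-neighbour `b` of `a`: the contact edge to `B b` itself if it
  -- starts at `v`, and otherwise the first edge of a path in `B a` from `v` to the contact vertex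
  -- `x`.
  have key : ∀ b, ∃ w x y, F.Adj a b → ∃ hx : x ∈ B a, y ∈ B b ∧ G.Adj x y ∧
      ∀ S : Set V, w ∈ S → (x = v → y ∈ S) ∧
        ((G.restrictAt v S).induce (B a)).Reachable ⟨v, hva⟩ ⟨x, hx⟩ := by
    intro b
    by_cases hab : F.Adj a b
    swap
    · exact ⟨v, v, v, fun h => absurd h hab⟩
    obtain ⟨x, hx, y, hy, h⟩ := ha a b hab
    by_cases hxv : x = v
    · subst hxv
      exact ⟨y, x, y, fun _ => ⟨hx, hy, h, fun S hS => ⟨fun _ => hS, Reachable.refl _⟩⟩⟩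
    · obtain ⟨w, -, hw⟩ := exists_step_reachable (hc a) hva hx hxv
      exact ⟨w, x, y, fun _ => ⟨hx, hy, h, fun S hS => ⟨fun e => absurd e hxv, hw S hS⟩⟩⟩
  choose w x y hwxy using key
  set S : Set V := w '' F.neighborSet a with hS
  have hfin : (F.neighborSet a).Finite := Set.toFinite _
  refine ⟨S, hfin.image _, (Set.ncard_image_le hfin).trans (hdeg a), ?_⟩
  set R := G.restrictAt v S with hR
  -- After the restriction `B a` may fall apart. The component of `v` still contains all the contact
  -- vertices and serves as the new branch set.
  set c := (R.induce (B a)).connectedComponentMk ⟨v, hva⟩ with hcdef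
  have hBa : ∀ z, z ∈ Subtype.val '' c.supp ↔
      ∃ hz : z ∈ B a, (R.induce (B a)).Reachable ⟨v, hva⟩ ⟨z, hz⟩ := by
    intro z
    constructor
    · rintro ⟨⟨z, hz⟩, h, rfl⟩
      exact ⟨hz, (ConnectedComponent.exact h).symm⟩
    · rintro ⟨hz, h⟩
      exact ⟨⟨z, hz⟩, ConnectedComponent.sound h.symm, rfl⟩
  have hsub : Subtype.val '' c.supp ⊆ B a := by
    rintro _ ⟨z, -, rfl⟩
    exact z.2
  have hedge : ∀ b, F.Adj a b → x b ∈ Subtype.val '' c.supp ∧ y b ∈ B b ∧ R.Adj (x b) (y b) := by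
    intro b hab
    obtain ⟨hx, hy, h, h'⟩ := hwxy b hab
    have hw : w b ∈ S := ⟨b, hab, rfl⟩
    refine ⟨(hBa _).2 ⟨hx, (h' S hw).2⟩, hy, h, (h' S hw).1, fun e => ?_⟩
    exact absurd (e ▸ hy) (hvb b hab.ne')
  have hsubB : ∀ b, Function.update B a (Subtype.val '' c.supp) b ⊆ B b := by
    intro b
    by_cases hb : b = a
    · subst hb
      simp
    · rw [Function.update_of_ne hb]
  refine ⟨Function.update B a (Subtype.val '' c.supp), fun b => (hsubB b).trans (hs b), ?_, ?_, ?_⟩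
  · intro b
    by_cases hb : b = a
    · subst hb
      rw [Function.update_self]
      refine ((induceInduceIso R (B b) c.supp).connected_iff).1 ?_
      exact c.connected_toSimpleGraph
    · rw [Function.update_of_ne hb]
      exact connected_induce_restrictAt (hvb b hb) (hc b)
  · intro b b' hbb
    exact (hd b b' hbb).mono (hsubB b) (hsubB b')
  · intro b b' hbb
    by_cases hb : b = a
    · subst hb
      rw [Function.update_self, Function.update_of_ne hbb.ne']
      obtain ⟨h1, h2, h3⟩ := hedge b' hbb
      exact ⟨_, h1, _, h2, h3⟩
    · rw [Function.update_of_ne hb]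
      by_cases hb' : b' = a
      · subst hb'
        rw [Function.update_self]
        obtain ⟨h1, h2, h3⟩ := hedge b hbb.symm
        exact ⟨_, h2, _, h1, h3.symm⟩
      · rw [Function.update_of_ne hb']
        obtain ⟨x, hx, y, hy, h⟩ := ha b b' hbb
        exact ⟨x, hx, y, hy, h, fun e => absurd (e ▸ hx) (hvb b hb),
          fun e => absurd (e ▸ hy) (hvb b' hb')⟩

/-- A minor of a finite graph is a minor of a subgraph whose degrees do not exceed those of the
minor. -/
theorem MinorIn.exists_le_degree_le [Finite V] [Finite W] {F : SimpleGraph W} {G : SimpleGraph V}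
    {s : Set V} {d : ℕ} (hdeg : ∀ a, (F.neighborSet a).ncard ≤ d) (h : MinorIn F G s) :
    ∃ H ≤ G, (∀ v, (H.neighborSet v).ncard ≤ d) ∧ MinorIn F H s := by
  have : Finite (SimpleGraph V) := Finite.of_injective SimpleGraph.Adj fun _ _ => SimpleGraph.ext
  obtain ⟨H, hH, hmin⟩ := (Set.toFinite {H : SimpleGraph V | H ≤ G ∧ MinorIn F H s}).exists_minimal
    ⟨G, le_rfl, h⟩
  refine ⟨H, hH.1, fun v => ?_, hH.2⟩
  obtain ⟨S, hfin, hS, h'⟩ := hH.2.exists_restrictAt hdeg v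
  -- By minimality the restriction removes nothing, so all `H`-neighbours of `v` are in `S`.
  have hle : H ≤ H.restrictAt v S :=
    hmin ⟨(H.restrictAt_le v S).trans hH.1, h'⟩ (H.restrictAt_le v S)
  refine (Set.ncard_le_ncard ?_ hfin).trans hS
  intro w hw
  exact (hle hw).2.1 rfl

/-- The image of a minor model under a permutation of the vertices. -/
theorem MinorIn.map_equiv {F : SimpleGraph W} {G : SimpleGraph V} {s : Set V}
    (h : MinorIn F G s) (e : V ≃ V) : MinorIn F (G.map e.toEmbedding) (e '' s) := by
  obtain ⟨B, hs, hc, hd, ha⟩ := h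
  refine ⟨fun a => e '' B a, fun a => Set.image_mono (hs a), fun a => ?_, fun a b hab => ?_,
    fun a b hab => ?_⟩
  · have iso : G.induce (B a) ≃g (G.map e.toEmbedding).induce (e '' B a) :=
      { toEquiv := e.image (B a)
        map_rel_iff' := by
          rintro ⟨x, hx⟩ ⟨y, hy⟩
          exact map_adj_apply }
    exact iso.connected_iff.1 (hc a)
  · exact (Set.disjoint_image_iff e.injective).2 (hd a b hab)
  · obtain ⟨x, hx, y, hy, h⟩ := ha a b hab
    exact ⟨e x, ⟨x, hx, rfl⟩, e y, ⟨y, hy, rfl⟩, map_adj_apply.2 h⟩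

end SimpleGraph

/-! ### Transfer of minors to a sparser graph by exchanging vertices. -/

namespace SimpleGraph

variable {V W : Type*}

/-- Dropping all edges not inside `s` turns the condition on the branch sets into one on the support
of the graph, which is easy to follow through exchanges of vertices. -/
theorem MinorIn.restrict {F : SimpleGraph W} {G : SimpleGraph V} {s : Set V}
    (h : MinorIn F G s) : ∃ H ≤ G, H.support ⊆ s ∧ MinorIn F H s := by
  obtain ⟨B, hs, hc, hd, ha⟩ := h
  refine ⟨⟨fun x y => G.Adj x y ∧ x ∈ s ∧ y ∈ s, ⟨fun _ _ h => ⟨h.1.symm, h.2.2, h.2.1⟩⟩,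
    ⟨fun _ h => h.1.ne rfl⟩⟩, fun _ _ h => h.1, fun x ⟨_, hx⟩ => hx.2.1, B, hs, fun a => ?_, hd,
    fun a b hab => ?_⟩
  · refine (hc a).mono ?_
    rintro ⟨x, hx⟩ ⟨y, hy⟩ hxy
    exact ⟨hxy, hs a hx, hs a hy⟩
  · obtain ⟨x, hx, y, hy, h⟩ := ha a b hab
    exact ⟨x, hx, y, hy, h, hs a hx, hs b hy⟩

/-- Each such vertex is an `H`-neighbour of some element of `A`, and each element of `A` has at most
`d` neighbours. -/
theorem ncard_support_sdiff_le [Fintype V] {H : SimpleGraph V} {A : Finset V} {d : ℕ}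
    (hH : ∀ v, (H.neighborSet v).ncard ≤ d) (hI : ∀ u ∉ A, ∀ w ∉ A, ¬ H.Adj u w) :
    (H.support \ A).ncard ≤ A.card * d := by
  classical
  have hsub : H.support \ A ⊆ (A.biUnion fun a => (Set.toFinite (H.neighborSet a)).toFinset) := by
    rintro x ⟨⟨y, hy⟩, hx⟩
    have hyA : y ∈ A := by
      by_contra hyA
      exact hI x hx y hyA hy
    simp only [Finset.coe_biUnion, Set.mem_iUnion]
    exact ⟨y, hyA, by simpa using hy.symm⟩
  refine (Set.ncard_le_ncard hsub (Finset.finite_toSet _)).trans ?_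
  rw [Set.ncard_coe_finset]
  refine Finset.card_biUnion_le_card_mul _ _ _ fun a _ => ?_
  rw [← Set.ncard_eq_toFinset_card]
  exact hH a

/-- As `u` is isolated in `H`, the swap just moves the star at `v` to `u` and leaves `v` isolated.
-/
theorem map_swap_adj [DecidableEq V] {H : SimpleGraph V} {u v x y : V} (hu : u ∉ H.support)
    (h : (H.map (Equiv.swap v u).toEmbedding).Adj x y) :
    (H.Adj x y ∧ x ≠ v ∧ y ≠ v) ∨ (x = u ∧ H.Adj v y) ∨ (y = u ∧ H.Adj v x) := by
  rw [map_adj] at h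
  obtain ⟨a, b, hab, rfl, rfl⟩ := h
  have hau : a ≠ u := by
    rintro rfl
    exact hu ⟨b, hab⟩
  have hbu : b ≠ u := by
    rintro rfl
    exact hu ⟨a, hab.symm⟩
  simp only [Equiv.coe_toEmbedding]
  by_cases hav : a = v
  · subst hav
    rw [Equiv.swap_apply_left, Equiv.swap_apply_of_ne_of_ne hab.ne' hbu]
    exact Or.inr (Or.inl ⟨rfl, hab⟩)
  · rw [Equiv.swap_apply_of_ne_of_ne hav hau]
    by_cases hbv : b = v
    · subst hbv
      rw [Equiv.swap_apply_left]
      exact Or.inr (Or.inr ⟨rfl, hab.symm⟩)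
    · rw [Equiv.swap_apply_of_ne_of_ne hbv hbu]
      exact Or.inl ⟨hab, hav, hbv⟩

/-- If `G'` contains all edges of `G` within `A`, and for every vertex `v` of the independent set
outside `A` and every small set of neighbours of `v` either `G'` retains the edges in question or
there are many common neighbours in `G'`, then the minors of bounded degree of `G ∖ X`, for small
sets `X`, are minors of `G' ∖ X`. -/
theorem MinorIn.transfer [Fintype V] [Finite W] [Nontrivial W] {F : SimpleGraph W}
    (hF : F.Connected) {d : ℕ} (hdeg : ∀ a, (F.neighborSet a).ncard ≤ d)
    {G G' : SimpleGraph V} (hle : G' ≤ G) {A X : Finset V} {N : ℕ}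
    (hI : ∀ u ∉ A, ∀ w ∉ A, ¬ G.Adj u w)
    (hA : ∀ u ∈ A, ∀ w ∈ A, G.Adj u w → G'.Adj u w)
    (hN : X.card + A.card * d < N)
    (hcommon : ∀ v ∉ A, ∀ S : Finset V, S.Nonempty → S.card ≤ d → (∀ s ∈ S, G.Adj v s) →
      (∀ s ∈ S, G'.Adj v s) ∨
        ∃ U : Finset V, N ≤ U.card ∧ ∀ u ∈ U, u ∉ A ∧ ∀ s ∈ S, G'.Adj u s)
    (h : MinorIn F G {v | v ∉ X}) : MinorIn F G' {v | v ∉ X} := by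
  classical
  -- Induction on the number of bad vertices, those outside `A` at which `H` uses an edge missing
  -- from `G'`.
  suffices key : ∀ m, ∀ H ≤ G, (∀ v, (H.neighborSet v).ncard ≤ d) → H.support ⊆ {v | v ∉ X} →
      MinorIn F H Set.univ → {v | v ∉ A ∧ ∃ s, H.Adj v s ∧ ¬ G'.Adj v s}.ncard ≤ m →
      MinorIn F G' {v | v ∉ X} by
    obtain ⟨H₀, hH₀, hX, h₀⟩ := h.restrict
    obtain ⟨H, hH, hd, h⟩ := h₀.exists_le_degree_le hdeg
    exact key _ H (hH.trans hH₀) hd ((support_mono hH).trans hX)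
      (h.mono le_rfl (Set.subset_univ _)) le_rfl
  intro m
  induction m with
  | zero =>
    intro H hH hd hX h hm
    rw [Nat.le_zero, Set.ncard_eq_zero (Set.toFinite _)] at hm
    have hgood : ∀ v ∉ A, ∀ s, H.Adj v s → G'.Adj v s := by
      intro v hv s hs
      by_contra hc
      exact Set.eq_empty_iff_forall_notMem.1 hm v ⟨hv, s, hs, hc⟩
    refine (h.support hF).mono (fun x y hxy => ?_) hX
    by_cases hx : x ∈ A
    · by_cases hy : y ∈ A
      · exact hA x hx y hy (hH hxy)
      · exact (hgood y hy x hxy.symm).symm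
    · exact hgood x hx y hxy
  | succ m ih =>
    intro H hH hd hX h hm
    by_cases hbad : ∃ v, v ∉ A ∧ ∃ s, H.Adj v s ∧ ¬ G'.Adj v s
    swap
    · refine ih H hH hd hX h ?_
      rw [(Set.eq_empty_iff_forall_notMem.2 fun v hv => hbad ⟨v, hv⟩ :
        {v | v ∉ A ∧ ∃ s, H.Adj v s ∧ ¬ G'.Adj v s} = ∅)]
      simp
    obtain ⟨v, hv, s, hs, hs'⟩ := hbad
    set S : Finset V := (Set.toFinite (H.neighborSet v)).toFinset with hS
    have hmemS : ∀ x, x ∈ S ↔ H.Adj v x := by simp [hS]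
    have hSA : ∀ x ∈ S, x ∈ A := by
      intro x hx
      by_contra hxA
      exact hI v hv x hxA (hH ((hmemS x).1 hx))
    have hSd : S.card ≤ d := by
      rw [hS, ← Set.ncard_eq_toFinset_card]
      exact hd v
    obtain hc | ⟨U, hUc, hU⟩ := hcommon v hv S ⟨s, (hmemS s).2 hs⟩ hSd
      fun x hx => hH ((hmemS x).1 hx)
    · exact absurd (hc s ((hmemS s).2 hs)) hs'
    have hUfresh : ∃ u ∈ U, u ∉ X ∧ u ∉ H.support := by
      by_contra! hno
      -- If no candidate were free, `U` would have at most `|X| + |A| * d < N` elements.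
      have hsub : U ⊆ X ∪ (Set.toFinite (H.support \ A)).toFinset := by
        intro u hu
        by_cases huX : u ∈ X
        · simp [huX]
        · have := hno u hu huX
          simp [huX, this, (hU u hu).1]
      have h1 := Finset.card_le_card hsub
      have h2 := ncard_support_sdiff_le (A := A) hd fun a ha b hb hab => hI a ha b hb (hH hab)
      rw [Set.ncard_eq_toFinset_card] at h2
      have h3 := Finset.card_union_le X (Set.toFinite (H.support \ A)).toFinset
      omega
    obtain ⟨u, huU, huX, huH⟩ := hUfresh
    obtain ⟨huA, huS⟩ := hU u huU
    refine ih (H.map (Equiv.swap v u).toEmbedding) ?_ ?_ ?_ ?_ ?_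
    · intro x y hxy
      obtain h' | ⟨rfl, h'⟩ | ⟨rfl, h'⟩ := map_swap_adj huH hxy
      · exact hH h'.1
      · exact hle (huS y ((hmemS y).2 h'))
      · exact (hle (huS x ((hmemS x).2 h'))).symm
    · intro x
      refine le_trans ?_ (hd ((Equiv.swap v u).symm x))
      refine (Set.ncard_le_ncard ?_ (Set.toFinite _)).trans
        (Set.ncard_image_le (f := Equiv.swap v u) (Set.toFinite _))
      intro y hy
      rw [mem_neighborSet, map_adj] at hy
      obtain ⟨a, b, hab, rfl, rfl⟩ := hy
      exact ⟨b, by simpa using hab, rfl⟩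
    · rintro x ⟨y, hxy⟩
      obtain h' | ⟨rfl, h'⟩ | ⟨rfl, h'⟩ := map_swap_adj huH hxy
      · exact hX ⟨y, h'.1⟩
      · exact huX
      · exact hX ⟨v, h'.symm⟩
    · exact (h.map_equiv (Equiv.swap v u)).mono le_rfl (Set.subset_univ _)
    · rw [← Nat.lt_succ_iff]
      refine lt_of_lt_of_le (Set.ncard_lt_ncard ?_ (Set.toFinite _)) hm
      -- The vertex `v` is now isolated, the edges at `u` are all in `G'`, and no other vertex
      -- outside `A` has gained an edge.
      refine Set.ssubset_iff_exists.2 ⟨?_, v, ⟨hv, s, hs, hs'⟩, ?_⟩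
      · rintro x ⟨hx, y, hxy, hxy'⟩
        obtain h' | ⟨rfl, h'⟩ | ⟨rfl, h'⟩ := map_swap_adj huH hxy
        · exact ⟨hx, y, h'.1, hxy'⟩
        · exact absurd (huS y ((hmemS y).2 h')) hxy'
        · exact absurd (hSA x ((hmemS x).2 h')) hx
      · rintro ⟨-, y, hy, hy'⟩
        obtain h' | ⟨rfl, h'⟩ | ⟨rfl, h'⟩ := map_swap_adj huH hy
        · exact h'.2.1 rfl
        · exact huH ⟨y, h'⟩
        · exact h'.ne rfl

end SimpleGraph

/-! ### Computability of list operations and of bounded enumerations of lists. -/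

section PrimrecLists

variable {α β γ : Type*} [Primcodable α] [Primcodable β] [Primcodable γ]

theorem Primrec.list_any {f : γ → List β} {p : γ → β → Bool} (hf : Primrec f)
    (hp : Primrec fun x : γ × β => p x.1 x.2) : Primrec fun g => (f g).any (p g) := by
  refine (Primrec.list_foldr (h := fun g x => p g x.1 || x.2) hf (Primrec.const false)
    (Primrec.or.comp (hp.comp (Primrec.fst.pair (Primrec.fst.comp Primrec.snd)))
      (Primrec.snd.comp Primrec.snd))).of_eq fun g => ?_
  induction f g with
  | nil => rfl
  | cons a l ih => simp [← ih]

theorem Primrec.list_all {f : γ → List β} {p : γ → β → Bool} (hf : Primrec f)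
    (hp : Primrec fun x : γ × β => p x.1 x.2) : Primrec fun g => (f g).all (p g) := by
  refine (Primrec.not.comp (Primrec.list_any hf (p := fun g b => !p g b)
    (Primrec.not.comp hp))).of_eq fun g => ?_
  induction f g <;> simp [*]

theorem Primrec.list_filter {f : γ → List β} {p : γ → β → Bool} (hf : Primrec f)
    (hp : Primrec fun x : γ × β => p x.1 x.2) : Primrec fun g => (f g).filter (p g) := by
  refine (Primrec.list_foldr (h := fun g x => bif p g x.1 then x.1 :: x.2 else x.2) hf
    (Primrec.const []) (Primrec.cond (hp.comp (Primrec.fst.pair (Primrec.fst.comp Primrec.snd)))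
      (Primrec.list_cons.comp (Primrec.fst.comp Primrec.snd) (Primrec.snd.comp Primrec.snd))
      (Primrec.snd.comp Primrec.snd))).of_eq fun g => ?_
  induction f g with
  | nil => rfl
  | cons a l ih =>
    rw [List.foldr_cons, ih, List.filter_cons]
    cases p g a <;> rfl

theorem Primrec.decide_eq [DecidableEq β] {f g : γ → β} (hf : Primrec f) (hg : Primrec g) :
    Primrec fun x => decide (f x = g x) :=
  PrimrecPred.decide (Primrec.eq.comp hf hg)

theorem Primrec.decide_mem {f : γ → β} {l : γ → List β} [∀ x, Decidable (f x ∈ l x)]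
    (hf : Primrec f) (hl : Primrec l) : Primrec fun x => decide (f x ∈ l x) := by
  classical
  refine (Primrec.list_any (p := fun x b => decide (f x = b)) hl
    (Primrec.decide_eq (hf.comp Primrec.fst) Primrec.snd)).of_eq fun x => ?_
  simp [List.any_eq]

/-- Membership in the family is assumed to be merely computable, so the final test needs this
version besides the primitive recursive one. -/
theorem Computable.list_any {p : β → Bool} (hp : Computable p) :
    Computable fun l : List β => l.any p := by
  have h : Computable fun l : List β => Nat.rec (motive := fun _ => Bool) false
      (fun i b => b || (Option.casesOn (motive := fun _ => Bool) (l[i]?) false p)) l.length := by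
    refine Computable.nat_rec (h := fun (l : List β) (x : ℕ × Bool) =>
      x.2 || (Option.casesOn (motive := fun _ => Bool) (l[x.1]?) false p))
      Computable.list_length (Computable.const false) ?_
    refine Computable₂.comp Primrec.or.to_comp (Computable.snd.comp Computable.snd) ?_
    refine Computable.option_casesOn ?_ (Computable.const false) (hp.comp Computable.snd)
    exact Computable.list_getElem?.comp Computable.fst (Computable.fst.comp Computable.snd)
  refine h.of_eq fun l => ?_
  have key : ∀ m ≤ l.length, (Nat.rec (motive := fun _ => Bool) false
      (fun i b => b || (Option.casesOn (motive := fun _ => Bool) (l[i]?) false p)) m) =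
        (l.take m).any p := by
    intro m
    induction m with
    | zero => intro _; simp
    | succ m ih =>
      intro hm
      have hm' : m < l.length := hm
      simp only [ih (Nat.le_of_succ_le hm), List.take_add_one, List.any_append,
        List.getElem?_eq_getElem hm']
      simp
  rw [key _ le_rfl, List.take_length]

theorem Computable.list_all {p : β → Bool} (hp : Computable p) :
    Computable fun l : List β => l.all p := by
  refine (Primrec.not.to_comp.comp (Computable.list_any (p := fun b => !p b)
    (Primrec.not.to_comp.comp hp))).of_eq fun l => ?_
  induction l <;> simp [*]

/-- The lists that are built up from the empty list by at most `r` times adding in front an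
element of `A` that is admissible according to `ok`. -/
def growLists (ok : List α → α → Bool) (A : List α) (r : ℕ) : List (List α) :=
  Nat.rec [[]] (fun _ L => L.flatMap fun l => l :: (A.filter (ok l)).map (· :: l)) r

/-- All elements of a list are in `A`, and were admissible when they were added. -/
def IsGrown (ok : List α → α → Bool) (A : List α) : List α → Prop
  | [] => True
  | a :: l => a ∈ A ∧ ok l a = true ∧ IsGrown ok A l

omit [Primcodable α] in
theorem mem_growLists {ok : List α → α → Bool} {A : List α} {r : ℕ} {l : List α} :
    l ∈ growLists ok A r ↔ l.length ≤ r ∧ IsGrown ok A l := by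
  induction r generalizing l with
  | zero =>
    cases l <;> simp [growLists, IsGrown]
  | succ r ih =>
    have hs : growLists ok A (r + 1) =
      (growLists ok A r).flatMap fun l => l :: (A.filter (ok l)).map (· :: l) := rfl
    rw [hs, List.mem_flatMap]
    constructor
    · rintro ⟨l', hl', hl⟩
      rw [ih] at hl'
      rw [List.mem_cons, List.mem_map] at hl
      obtain rfl | ⟨a, ha, rfl⟩ := hl
      · exact ⟨hl'.1.trans (Nat.le_succ r), hl'.2⟩
      · rw [List.mem_filter] at ha
        exact ⟨Nat.succ_le_succ hl'.1, ha.1, ha.2, hl'.2⟩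
    · rintro ⟨h1, h2⟩
      cases l with
      | nil => exact ⟨[], ih.2 ⟨Nat.zero_le _, trivial⟩, List.mem_cons_self⟩
      | cons a l =>
        refine ⟨l, ih.2 ⟨Nat.le_of_succ_le_succ h1, h2.2.2⟩, List.mem_cons_of_mem _ ?_⟩
        exact List.mem_map.2 ⟨a, List.mem_filter.2 ⟨h2.1, h2.2.1⟩, rfl⟩

theorem Primrec.growLists {ok : γ → List α → α → Bool} {A : γ → List α} {r : γ → ℕ}
    (hok : Primrec fun x : (γ × List α) × α => ok x.1.1 x.1.2 x.2) (hA : Primrec A)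
    (hr : Primrec r) : Primrec fun g => growLists (ok g) (A g) (r g) := by
  refine Primrec.nat_rec' (h := fun g (x : ℕ × List (List α)) =>
    x.2.flatMap fun l => l :: ((A g).filter (ok g l)).map (· :: l)) hr (Primrec.const [[]]) ?_
  refine Primrec.list_flatMap (Primrec.snd.comp Primrec.snd) ?_
  refine Primrec.list_cons.comp Primrec.snd ?_
  refine Primrec.list_map ?_ (Primrec.list_cons.comp Primrec.snd
    (Primrec.snd.comp Primrec.fst))
  refine Primrec.list_filter (hA.comp (Primrec.fst.comp Primrec.fst)) ?_
  exact hok.comp (((Primrec.fst.comp (Primrec.fst.comp Primrec.fst)).pair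
    (Primrec.snd.comp Primrec.fst)).pair Primrec.snd)

/-- The lists over `A` of length at most `r`. -/
def listsUpTo (A : List α) (r : ℕ) : List (List α) :=
  growLists (fun _ _ => true) A r

omit [Primcodable α] in
theorem mem_listsUpTo {A : List α} {r : ℕ} {l : List α} :
    l ∈ listsUpTo A r ↔ l.length ≤ r ∧ ∀ a ∈ l, a ∈ A := by
  rw [listsUpTo, mem_growLists]
  refine and_congr Iff.rfl ?_
  induction l with
  | nil => simp [IsGrown]
  | cons a l ih => simp [IsGrown, ih]

theorem Primrec.listsUpTo {A : γ → List α} {r : γ → ℕ} (hA : Primrec A)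
    (hr : Primrec r) : Primrec fun g => listsUpTo (A g) (r g) :=
  Primrec.growLists (ok := fun _ _ _ => true) (Primrec.const true) hA hr

end PrimrecLists

/-! ### The functions that make up the algorithm. -/

namespace MinorStream

/-- The algorithm stores a list of pairs. A pair `(a, a)` says that `a` is matched, all other pairs
are edges, listed with the endpoint first during whose exposure they were stored. -/
abbrev Store : Type := List (ℕ × ℕ)

/-- The number of stored unmatched vertices other than `v` that are adjacent to all of `S`. -/
def countCommon (n v : ℕ) (P : Store) (S : List ℕ) : ℕ :=
  ((List.range n).filter fun u =>
    (!decide (u = v) && !decide ((u, u) ∈ P)) && S.all fun s => decide ((u, s) ∈ P)).length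

/-- Whether the edge `(v, b)` is to be kept: it belongs to a small set of edges at `v` whose
endpoints do not yet have `N` common neighbours. -/
def keepEdge (n d N v : ℕ) (P : Store) (b : ℕ) : Bool :=
  (listsUpTo (P.map Prod.snd) d).any fun S =>
    (decide (b ∈ S) && S.all fun s => decide ((v, s) ∈ P)) &&
      !decide (N ≤ countCommon n v P S)

/-- Clean up after the exposure of `v`. -/
def finalize (n d N v : ℕ) (P : Store) : Store :=
  P.filter fun e => (decide ((v, v) ∈ P) || !decide (e.1 = v)) || keepEdge n d N v P e.2

/-- Process the edge `(v, w)` during the exposure of `v`. -/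
def addEdge (v w : ℕ) (P : Store) : Store :=
  bif decide ((w, w) ∈ P) then (v, w) :: P
  else bif decide ((v, v) ∈ P) then P
  else (v, w) :: (v, v) :: (w, w) :: P

/-- One step of the algorithm, on the level of the current vertex and the stored pairs. -/
def stepStore (n d N : ℕ) (s : ℕ × Store) (t : ALToken) : ℕ × Store :=
  Sum.casesOn t (fun v => (v, finalize n d N s.1 s.2)) fun e => (e.1, addEdge e.1 e.2 s.2)

/-- Write a state into the memory. -/
def encodeState (s : ℕ × Store) : List ℕ :=
  s.1 :: s.2.flatMap fun e => [e.1, e.2]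

/-- Read a state from the memory. -/
def decodeState (l : List ℕ) : ℕ × Store :=
  (l.getI 0, (List.range (l.length / 2)).map fun i => (l.getI (2 * i + 1), l.getI (2 * i + 2)))

/-- Adjacency in a graph that is given by a list of edges. -/
def codeAdj (Q : Store) (x y : ℕ) : Bool :=
  !decide (x = y) && (decide ((x, y) ∈ Q) || decide ((y, x) ∈ Q))

/-- Whether the vertex `e.2` can be added to the branch set with label `e.1`. -/
def canExtend (Q : Store) (X : List ℕ) (l : List (ℕ × ℕ)) (e : ℕ × ℕ) : Bool :=
  (!decide (e.2 ∈ X) && !l.any fun f => decide (f.2 = e.2)) &&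
    ((!l.any fun f => decide (f.1 = e.1)) ||
      l.any fun f => decide (f.1 = e.1) && codeAdj Q f.2 e.2)

/-- The pairs of a number below `m` and a number below `n`. -/
def pairsBelow (m n : ℕ) : List (ℕ × ℕ) :=
  (List.range m).flatMap fun a => (List.range n).map fun x => (a, x)

/-- Whether the branch sets that are described by `l` form a minor model of the graph `c`. -/
def isModel (c : ℕ × Store) (Q : Store) (l : List (ℕ × ℕ)) : Bool :=
  ((List.range c.1).all fun a => l.any fun e => decide (e.1 = a)) &&
    (pairsBelow c.1 c.1).all fun ab => !codeAdj c.2 ab.1 ab.2 ||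
      l.any fun e => l.any fun f =>
        (decide (e.1 = ab.1) && decide (f.1 = ab.2)) && codeAdj Q e.2 f.2

/-- Whether the graph `c` is a minor of the graph `(n, Q)` without the vertices in `X`. -/
def minorTest (n : ℕ) (Q : Store) (X : List ℕ) (c : ℕ × Store) : Bool :=
  (growLists (canExtend Q X) (pairsBelow c.1 n) n).any (isModel c Q)

/-- Codes for all graphs on at most `n` vertices. -/
def allCodes (n : ℕ) : List (ℕ × Store) :=
  (List.range (n + 1)).flatMap fun m =>
    (listsUpTo (pairsBelow m m) (m * m)).map fun E => (m, E)

/-- For all candidate sets `X`, the list of all minors of the graph `(n, Q)` without `X`. -/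
def minorLists (n k : ℕ) (Q : Store) : List (List (ℕ × Store)) :=
  (listsUpTo (List.range n) k).map fun X => (allCodes n).filter (minorTest n Q X)

/-! ### Primitive recursiveness of these functions. -/

section Primrec

open Primrec

variable {γ : Type*} [Primcodable γ]

theorem primrec_countCommon {n v : γ → ℕ} {P : γ → Store} {S : γ → List ℕ} (hn : Primrec n)
    (hv : Primrec v) (hP : Primrec P) (hS : Primrec S) :
    Primrec fun g => countCommon (n g) (v g) (P g) (S g) := by
  refine list_length.comp (list_filter (list_range.comp hn) ?_)
  refine Primrec.and.comp (Primrec.and.comp (Primrec.not.comp ?_) (Primrec.not.comp ?_)) ?_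
  · exact decide_eq snd (hv.comp fst)
  · exact decide_mem (snd.pair snd) (hP.comp fst)
  · refine list_all (hS.comp fst) ?_
    exact decide_mem ((snd.comp fst).pair snd) (hP.comp (fst.comp fst))

theorem primrec_keepEdge {n d N v b : γ → ℕ} {P : γ → Store} (hn : Primrec n) (hd : Primrec d)
    (hN : Primrec N) (hv : Primrec v) (hP : Primrec P) (hb : Primrec b) :
    Primrec fun g => keepEdge (n g) (d g) (N g) (v g) (P g) (b g) := by
  refine list_any (Primrec.listsUpTo (list_map (g := fun _ e => e.2) hP
    (show Primrec₂ fun (_ : γ) (e : ℕ × ℕ) => e.2 from snd.comp snd)) hd) ?_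
  refine Primrec.and.comp (Primrec.and.comp ?_ ?_) (Primrec.not.comp ?_)
  · exact decide_mem (hb.comp fst) snd
  · refine list_all snd ?_
    exact decide_mem ((hv.comp (fst.comp fst)).pair snd) (hP.comp (fst.comp fst))
  · exact PrimrecPred.decide (Primrec.nat_le.comp (hN.comp fst)
      (primrec_countCommon (hn.comp fst) (hv.comp fst) (hP.comp fst) snd))

theorem primrec_finalize {n d N v : γ → ℕ} {P : γ → Store} (hn : Primrec n) (hd : Primrec d)
    (hN : Primrec N) (hv : Primrec v) (hP : Primrec P) :
    Primrec fun g => finalize (n g) (d g) (N g) (v g) (P g) := by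
  refine list_filter hP ?_
  refine Primrec.or.comp (Primrec.or.comp ?_ (Primrec.not.comp ?_)) ?_
  · exact decide_mem ((hv.comp fst).pair (hv.comp fst)) (hP.comp fst)
  · exact decide_eq (fst.comp snd) (hv.comp fst)
  · exact primrec_keepEdge (hn.comp fst) (hd.comp fst) (hN.comp fst) (hv.comp fst) (hP.comp fst)
      (snd.comp snd)

theorem primrec_addEdge {v w : γ → ℕ} {P : γ → Store} (hv : Primrec v) (hw : Primrec w)
    (hP : Primrec P) : Primrec fun g => addEdge (v g) (w g) (P g) := by
  refine Primrec.cond (decide_mem (hw.pair hw) hP) (list_cons.comp (hv.pair hw) hP) ?_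
  refine Primrec.cond (decide_mem (hv.pair hv) hP) hP ?_
  exact list_cons.comp (hv.pair hw) (list_cons.comp (hv.pair hv) (list_cons.comp (hw.pair hw) hP))

theorem primrec_stepStore {n d N : γ → ℕ} {s : γ → ℕ × Store} {t : γ → ALToken}
    (hn : Primrec n) (hd : Primrec d) (hN : Primrec N) (hs : Primrec s) (ht : Primrec t) :
    Primrec fun g => stepStore (n g) (d g) (N g) (s g) (t g) := by
  refine Primrec.sumCasesOn (g := fun g v => (v, finalize (n g) (d g) (N g) (s g).1 (s g).2))
    (h := fun g e => (e.1, addEdge e.1 e.2 (s g).2)) ht ?_ ?_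
  · exact snd.pair (primrec_finalize (hn.comp fst) (hd.comp fst) (hN.comp fst)
      (fst.comp (hs.comp fst)) (snd.comp (hs.comp fst)))
  · exact (fst.comp snd).pair (primrec_addEdge (fst.comp snd) (snd.comp snd)
      (snd.comp (hs.comp fst)))

theorem primrec_encodeState : Primrec encodeState := by
  refine list_cons.comp fst (list_flatMap snd ?_)
  exact list_cons.comp (fst.comp snd) (list_cons.comp (snd.comp snd) (Primrec.const []))

theorem primrec_decodeState : Primrec decodeState := by
  refine (list_getI.comp Primrec.id (Primrec.const 0)).pair ?_
  refine list_map (list_range.comp (nat_div.comp list_length (Primrec.const 2))) ?_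
  refine (list_getI.comp fst ?_).pair (list_getI.comp fst ?_)
  · exact nat_add.comp (nat_mul.comp (Primrec.const 2) snd) (Primrec.const 1)
  · exact nat_add.comp (nat_mul.comp (Primrec.const 2) snd) (Primrec.const 2)

theorem primrec_codeAdj {Q : γ → Store} {x y : γ → ℕ} (hQ : Primrec Q) (hx : Primrec x)
    (hy : Primrec y) : Primrec fun g => codeAdj (Q g) (x g) (y g) :=
  Primrec.and.comp (Primrec.not.comp (decide_eq hx hy))
    (Primrec.or.comp (decide_mem (hx.pair hy) hQ) (decide_mem (hy.pair hx) hQ))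

theorem primrec_canExtend {Q : γ → Store} {X : γ → List ℕ} {l : γ → List (ℕ × ℕ)}
    {e : γ → ℕ × ℕ} (hQ : Primrec Q) (hX : Primrec X) (hl : Primrec l) (he : Primrec e) :
    Primrec fun g => canExtend (Q g) (X g) (l g) (e g) := by
  have h : Primrec fun x : γ × (ℕ × ℕ) => decide (x.2.1 = (e x.1).1) :=
    decide_eq (fst.comp snd) (fst.comp (he.comp fst))
  refine Primrec.and.comp (Primrec.and.comp (Primrec.not.comp ?_) (Primrec.not.comp ?_))
    (Primrec.or.comp (Primrec.not.comp ?_) ?_)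
  · exact decide_mem (snd.comp he) hX
  · exact list_any hl (decide_eq (snd.comp snd) (snd.comp (he.comp fst)))
  · exact list_any hl h
  · exact list_any hl (Primrec.and.comp h
      (primrec_codeAdj (hQ.comp fst) (snd.comp snd) (snd.comp (he.comp fst))))

theorem primrec_pairsBelow {m n : γ → ℕ} (hm : Primrec m) (hn : Primrec n) :
    Primrec fun g => pairsBelow (m g) (n g) := by
  refine list_flatMap (list_range.comp hm) ?_
  exact list_map (list_range.comp (hn.comp fst)) ((snd.comp fst).pair snd)

theorem primrec_isModel {c : γ → ℕ × Store} {Q : γ → Store} {l : γ → List (ℕ × ℕ)}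
    (hc : Primrec c) (hQ : Primrec Q) (hl : Primrec l) :
    Primrec fun g => isModel (c g) (Q g) (l g) := by
  refine Primrec.and.comp (list_all (list_range.comp (fst.comp hc)) ?_)
    (list_all (primrec_pairsBelow (fst.comp hc) (fst.comp hc)) ?_)
  · exact list_any (hl.comp fst) (decide_eq (fst.comp snd) (snd.comp fst))
  · refine Primrec.or.comp (Primrec.not.comp ?_) (list_any (hl.comp fst)
      (list_any (hl.comp (fst.comp fst)) ?_))
    · exact primrec_codeAdj (snd.comp (hc.comp fst)) (fst.comp snd) (snd.comp snd)
    · refine Primrec.and.comp (Primrec.and.comp ?_ ?_) ?_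
      · exact decide_eq (fst.comp (snd.comp fst)) (fst.comp (snd.comp (fst.comp fst)))
      · exact decide_eq (fst.comp snd) (snd.comp (snd.comp (fst.comp fst)))
      · exact primrec_codeAdj (hQ.comp (fst.comp (fst.comp fst))) (snd.comp (snd.comp fst))
          (snd.comp snd)

theorem primrec_minorTest {n : γ → ℕ} {Q : γ → Store} {X : γ → List ℕ} {c : γ → ℕ × Store}
    (hn : Primrec n) (hQ : Primrec Q) (hX : Primrec X) (hc : Primrec c) :
    Primrec fun g => minorTest (n g) (Q g) (X g) (c g) := by
  refine list_any (Primrec.growLists (ok := fun g => canExtend (Q g) (X g)) ?_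
    (primrec_pairsBelow (fst.comp hc) hn) hn) ?_
  · exact primrec_canExtend (hQ.comp (fst.comp fst)) (hX.comp (fst.comp fst)) (snd.comp fst) snd
  · exact primrec_isModel (hc.comp fst) (hQ.comp fst) snd

theorem primrec_allCodes {n : γ → ℕ} (hn : Primrec n) : Primrec fun g => allCodes (n g) := by
  refine list_flatMap (list_range.comp (Primrec.succ.comp hn)) ?_
  refine list_map (Primrec.listsUpTo (primrec_pairsBelow snd snd) (nat_mul.comp snd snd)) ?_
  exact (snd.comp fst).pair snd

theorem primrec_minorLists {n k : γ → ℕ} {Q : γ → Store} (hn : Primrec n) (hk : Primrec k)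
    (hQ : Primrec Q) : Primrec fun g => minorLists (n g) (k g) (Q g) := by
  refine list_map (Primrec.listsUpTo (list_range.comp hn) hk) ?_
  refine list_filter (primrec_allCodes (hn.comp fst)) ?_
  exact primrec_minorTest (hn.comp (fst.comp fst)) (hQ.comp (fst.comp fst)) (snd.comp fst) snd

end Primrec

/-- An encoding has odd length `2 * P.length + 1`, so halving gives the number of pairs, and no
index falls back on the default of `getI`. -/
theorem decodeState_encodeState (s : ℕ × Store) : decodeState (encodeState s) = s := by
  obtain ⟨v, P⟩ := s
  have hlen : (encodeState (v, P)).length / 2 = P.length := by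
    have : (P.flatMap fun e => [e.1, e.2]).length = 2 * P.length := by
      induction P with
      | nil => rfl
      | cons e P ih => simp only [List.flatMap_cons, List.length_append, ih]; simp; ring
    simp only [encodeState, List.length_cons, this]
    omega
  have hget : ∀ (P : Store) (i : ℕ) (h : i < P.length),
      (P.flatMap fun e => [e.1, e.2]).getI (2 * i) = P[i].1 ∧
        (P.flatMap fun e => [e.1, e.2]).getI (2 * i + 1) = P[i].2 := by
    intro P
    induction P with
    | nil => intro i h; simp at h
    | cons e P ih =>
      intro i h
      cases i with
      | zero => exact ⟨rfl, rfl⟩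
      | succ i => exact ih i (Nat.lt_of_succ_lt_succ h)
  refine Prod.ext rfl ?_
  simp only [decodeState, hlen]
  refine List.ext_getElem (by simp) fun i h1 h2 => ?_
  rw [List.getElem_map, List.getElem_range]
  exact Prod.ext (hget P i h2).1 (hget P i h2).2

end MinorStream

/-! ### Correctness of the brute-force search for minors. -/

namespace MinorStream

open SimpleGraph

theorem graphOfCode_adj {n : ℕ} {Q : Store} {x y : Fin n} :
    (graphOfCode (n, Q)).2.Adj x y ↔ codeAdj Q x y = true := by
  simp [graphOfCode, codeAdj, fromRel_adj, Fin.ext_iff]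

theorem mem_pairsBelow {m n : ℕ} {e : ℕ × ℕ} : e ∈ pairsBelow m n ↔ e.1 < m ∧ e.2 < n := by
  simp only [pairsBelow, List.mem_flatMap, List.mem_range, List.mem_map]
  constructor
  · rintro ⟨a, ha, x, hx, rfl⟩
    exact ⟨ha, hx⟩
  · rintro ⟨h1, h2⟩
    exact ⟨e.1, h1, e.2, h2, rfl⟩

theorem canExtend_iff {Q : Store} {X : List ℕ} {l : List (ℕ × ℕ)} {e : ℕ × ℕ} :
    canExtend Q X l e = true ↔ (e.2 ∉ X ∧ ∀ f ∈ l, f.2 ≠ e.2) ∧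
      ((∀ f ∈ l, f.1 ≠ e.1) ∨ ∃ f ∈ l, f.1 = e.1 ∧ codeAdj Q f.2 e.2 = true) := by
  unfold canExtend
  rw [Bool.and_eq_true, Bool.and_eq_true, Bool.or_eq_true, Bool.not_eq_true', Bool.not_eq_true',
    Bool.not_eq_true', List.any_eq_false, List.any_eq_false, List.any_eq_true]
  simp only [decide_eq_true_eq, decide_eq_false_iff_not, Bool.and_eq_true]

theorem isModel_iff {c : ℕ × Store} {Q : Store} {l : List (ℕ × ℕ)} :
    isModel c Q l = true ↔ (∀ a < c.1, ∃ e ∈ l, e.1 = a) ∧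
      ∀ a < c.1, ∀ b < c.1, codeAdj c.2 a b = true →
        ∃ e ∈ l, ∃ f ∈ l, (e.1 = a ∧ f.1 = b) ∧ codeAdj Q e.2 f.2 = true := by
  unfold isModel
  rw [Bool.and_eq_true, List.all_eq_true, List.all_eq_true]
  simp only [List.any_eq_true, decide_eq_true_eq, List.mem_range, Bool.or_eq_true,
    Bool.not_eq_true', Bool.and_eq_true, mem_pairsBelow]
  refine and_congr Iff.rfl ⟨fun h a ha b hb hab => ?_, fun h e he => ?_⟩
  · exact (h (a, b) ⟨ha, hb⟩).resolve_left (by simp [hab])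
  · cases hc : codeAdj c.2 e.1 e.2
    · exact Or.inl rfl
    · exact Or.inr (h e.1 he.1 e.2 he.2 hc)

section Grown

variable {m n : ℕ} {Q : Store} {X : List ℕ} {l : List (ℕ × ℕ)}

theorem IsGrown.bounds (h : IsGrown (canExtend Q X) (pairsBelow m n) l) :
    ∀ e ∈ l, e.1 < m ∧ e.2 < n ∧ e.2 ∉ X := by
  induction l with
  | nil => simp
  | cons e l ih =>
    obtain ⟨h1, h2, h3⟩ := h
    rw [mem_pairsBelow] at h1
    rw [canExtend_iff] at h2
    intro f hf
    obtain rfl | hf := List.mem_cons.1 hf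
    · exact ⟨h1.1, h1.2, h2.1.1⟩
    · exact ih h3 f hf

theorem IsGrown.nodup (h : IsGrown (canExtend Q X) (pairsBelow m n) l) :
    (l.map Prod.snd).Nodup := by
  induction l with
  | nil => simp
  | cons e l ih =>
    obtain ⟨h1, h2, h3⟩ := h
    rw [canExtend_iff] at h2
    rw [List.map_cons, List.nodup_cons]
    refine ⟨fun hmem => ?_, ih h3⟩
    obtain ⟨f, hf, hfe⟩ := List.mem_map.1 hmem
    exact h2.1.2 f hf hfe

/-- Every vertex is used at most once; this is why `n` rounds of `growLists` are enough in
`minorTest`. -/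
theorem IsGrown.length_le (h : IsGrown (canExtend Q X) (pairsBelow m n) l) : l.length ≤ n := by
  have h1 : (l.map Prod.snd) ⊆ List.range n := by
    intro x hx
    obtain ⟨e, he, rfl⟩ := List.mem_map.1 hx
    exact List.mem_range.2 (IsGrown.bounds h e he).2.1
  simpa using (List.subperm_of_subset (IsGrown.nodup h) h1).length_le

/-- A new vertex either opens its branch set or is adjacent to a vertex already there, so
connectedness is never lost. -/
theorem IsGrown.connected (h : IsGrown (canExtend Q X) (pairsBelow m n) l) (a : ℕ)
    (ha : ∃ e ∈ l, e.1 = a) :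
    ((graphOfCode (n, Q)).2.induce {x : Fin n | (a, (x : ℕ)) ∈ l}).Connected := by
  induction l with
  | nil => simp at ha
  | cons e l ih =>
    obtain ⟨h1, h2, h3⟩ := h
    rw [mem_pairsBelow] at h1
    rw [canExtend_iff] at h2
    by_cases hea : e.1 = a
    · have hset : {x : Fin n | (a, (x : ℕ)) ∈ e :: l} =
          {x : Fin n | (a, (x : ℕ)) ∈ l} ∪ {⟨e.2, h1.2⟩} := by
        ext x
        simp only [Set.mem_ofPred_eq, List.mem_cons, Set.mem_union, Set.mem_singleton_iff,
          Fin.ext_iff, Prod.ext_iff, hea]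
        tauto
      obtain h4 | ⟨f, hf, hfe, hadj⟩ := h2.2
      · have hempty : {x : Fin n | (a, (x : ℕ)) ∈ l} = ∅ := by
          rw [Set.eq_empty_iff_forall_notMem]
          intro x hx
          exact h4 _ hx hea.symm
        rw [hset, hempty, Set.empty_union]
        exact (connected_iff _).2 ⟨Preconnected.of_subsingleton, ⟨⟨_, rfl⟩⟩⟩
      · have hfl : (a, f.2) ∈ l := by
          rw [← hea, ← hfe]
          exact hf
        have hfn : f.2 < n := (IsGrown.bounds h3 f hf).2.1
        rw [hset]
        refine connected_induce_union (v := (⟨f.2, hfn⟩ : Fin n)) (w := ⟨e.2, h1.2⟩)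
          (ih h3 ⟨f, hf, hfe.trans hea⟩).preconnected Preconnected.of_subsingleton hfl rfl ?_
        · exact graphOfCode_adj.2 hadj
    · have hset : {x : Fin n | (a, (x : ℕ)) ∈ e :: l} = {x : Fin n | (a, (x : ℕ)) ∈ l} := by
        ext x
        simp only [Set.mem_ofPred_eq, List.mem_cons]
        refine or_iff_right fun hx => hea ?_
        rw [← hx]
      rw [hset]
      refine ih h3 ?_
      obtain ⟨f, hf, hfa⟩ := ha
      obtain rfl | hf := List.mem_cons.1 hf
      · exact absurd hfa hea
      · exact ⟨f, hf, hfa⟩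

end Grown

theorem minorIn_of_minorTest {n : ℕ} {Q : Store} {X : List ℕ} {c : ℕ × Store}
    (h : minorTest n Q X c = true) :
    MinorIn (graphOfCode c).2 (graphOfCode (n, Q)).2 {v : Fin n | (v : ℕ) ∉ X} := by
  obtain ⟨l, hl, hmod⟩ := List.any_eq_true.1 h
  obtain ⟨-, hl⟩ := mem_growLists.1 hl
  rw [isModel_iff] at hmod
  refine ⟨fun a => {x : Fin n | ((a : ℕ), (x : ℕ)) ∈ l}, fun a x hx => ?_, fun a => ?_,
    fun a b hab => ?_, fun a b hab => ?_⟩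
  · exact (IsGrown.bounds hl _ hx).2.2
  · exact IsGrown.connected hl a (hmod.1 a a.2)
  · rw [Set.disjoint_left]
    intro x hx hx'
    have := List.inj_on_of_nodup_map (IsGrown.nodup hl) hx hx' rfl
    exact hab (Fin.ext (congrArg Prod.fst this))
  · obtain ⟨e, he, f, hf, ⟨hea, hfb⟩, hadj⟩ :=
      hmod.2 a a.2 b b.2 (graphOfCode_adj (Q := c.2).1 hab)
    refine ⟨⟨e.2, (IsGrown.bounds hl e he).2.1⟩, ?_, ⟨f.2, (IsGrown.bounds hl f hf).2.1⟩, ?_, ?_⟩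
    · show ((a : ℕ), e.2) ∈ l
      rwa [← hea]
    · show ((b : ℕ), f.2) ∈ l
      rwa [← hfb]
    · exact graphOfCode_adj.2 hadj

/-- A longest grown list inside the given model exhausts all branch sets, since connectedness would
otherwise permit one more extension. -/
theorem minorTest_of_minorIn {n : ℕ} {Q : Store} {X : List ℕ} {c : ℕ × Store}
    (h : MinorIn (graphOfCode c).2 (graphOfCode (n, Q)).2 {v : Fin n | (v : ℕ) ∉ X}) :
    minorTest n Q X c = true := by
  obtain ⟨B, hs, hc, hd, hadj⟩ := h
  change Fin c.1 → Set (Fin n) at B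
  set ok := canExtend Q X with hok
  set A := pairsBelow c.1 n with hA
  let Fits : List (ℕ × ℕ) → Prop := fun l => IsGrown ok A l ∧
    ∀ e ∈ l, ∃ (h1 : e.1 < c.1) (h2 : e.2 < n), (⟨e.2, h2⟩ : Fin n) ∈ B ⟨e.1, h1⟩
  obtain ⟨l, hl, hmax⟩ : ∃ l, Fits l ∧ ∀ l', Fits l' → l'.length ≤ l.length := by
    have hmem := Nat.sSup_mem (s := {r | ∃ l, Fits l ∧ l.length = r})
      ⟨0, [], ⟨trivial, by simp⟩, rfl⟩
      ⟨n, by rintro _ ⟨l, hl, rfl⟩; exact IsGrown.length_le hl.1⟩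
    obtain ⟨l, hl, hlen⟩ := hmem
    refine ⟨l, hl, fun l' hl' => ?_⟩
    rw [hlen]
    exact le_csSup ⟨n, by rintro _ ⟨l, hl, rfl⟩; exact IsGrown.length_le hl.1⟩ ⟨l', hl', rfl⟩
  have hext : ∀ (a : Fin c.1) (x : Fin n), x ∈ B a → ((a : ℕ), (x : ℕ)) ∉ l →
      ((∀ f ∈ l, f.1 ≠ a) ∨ ∃ f ∈ l, f.1 = a ∧ codeAdj Q f.2 x = true) → False := by
    intro a x hx hxl hor
    have hfit : Fits (((a : ℕ), (x : ℕ)) :: l) := by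
      refine ⟨⟨mem_pairsBelow.2 ⟨a.2, x.2⟩, canExtend_iff.2 ⟨⟨hs a hx, ?_⟩, hor⟩, hl.1⟩, ?_⟩
      · intro f hf hfx
        obtain ⟨h1, h2, h3⟩ := hl.2 f hf
        have hx' : x = ⟨f.2, h2⟩ := Fin.ext hfx.symm
        by_cases hfa : (⟨f.1, h1⟩ : Fin c.1) = a
        · refine hxl ?_
          rw [← hfa, hx']
          exact hf
        · exact Set.disjoint_left.1 (hd _ _ hfa) h3 (hx' ▸ hx)
      · intro e he
        obtain rfl | he := List.mem_cons.1 he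
        · exact ⟨a.2, x.2, hx⟩
        · exact hl.2 e he
    have := hmax _ hfit
    simp at this
  have hall : ∀ (a : Fin c.1) (x : Fin n), x ∈ B a → ((a : ℕ), (x : ℕ)) ∈ l := by
    intro a x hx
    by_contra hxl
    by_cases hex : ∀ f ∈ l, f.1 ≠ a
    · exact hext a x hx hxl (Or.inl hex)
    push Not at hex
    obtain ⟨f, hf, hfa⟩ := hex
    obtain ⟨h1, h2, h3⟩ := hl.2 f hf
    have ha : (⟨f.1, h1⟩ : Fin c.1) = a := Fin.ext hfa
    rw [ha] at h3
    obtain ⟨p⟩ := (hc a).preconnected ⟨_, h3⟩ ⟨x, hx⟩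
    -- A walk in `B a` from a listed to an unlisted vertex has an edge that leaves the listed part;
    -- its end could be added.
    obtain ⟨e, -, he1, he2⟩ := p.exists_boundary_dart {z | ((a : ℕ), (z.1 : ℕ)) ∈ l}
      (show ((a : ℕ), f.2) ∈ l by rw [← hfa]; exact hf) hxl
    exact hext a e.snd.1 e.snd.2 he2 (Or.inr ⟨_, he1, rfl, graphOfCode_adj.1 e.adj⟩)
  refine List.any_eq_true.2 ⟨l, mem_growLists.2 ⟨IsGrown.length_le hl.1, hl.1⟩, ?_⟩
  rw [isModel_iff]
  constructor
  · intro a ha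
    obtain ⟨⟨x, hx⟩⟩ := (hc ⟨a, ha⟩).nonempty
    exact ⟨_, hall _ x hx, rfl⟩
  · intro a ha b hb hab
    obtain ⟨x, hx, y, hy, h⟩ := hadj ⟨a, ha⟩ ⟨b, hb⟩ (graphOfCode_adj.2 hab)
    exact ⟨_, hall _ x hx, _, hall _ y hy, ⟨rfl, rfl⟩, graphOfCode_adj.1 h⟩

/-- Every graph on at most `n` vertices has a code in the list. -/
theorem exists_mem_allCodes {n : ℕ} (F : FinGraph) (hF : F.1 ≤ n) :
    ∃ c ∈ allCodes n, graphOfCode c = F := by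
  classical
  obtain ⟨m, F⟩ := F
  let E : Store := (pairsBelow m m).filter fun e =>
    ∃ (h1 : e.1 < m) (h2 : e.2 < m), F.Adj ⟨e.1, h1⟩ ⟨e.2, h2⟩
  refine ⟨(m, E), ?_, ?_⟩
  · refine List.mem_flatMap.2 ⟨m, List.mem_range.2 (Nat.lt_succ_of_le hF), ?_⟩
    refine List.mem_map.2 ⟨E, mem_listsUpTo.2 ⟨?_, fun e he => (List.mem_filter.1 he).1⟩, rfl⟩
    refine (List.length_filter_le _ _).trans (le_of_eq ?_)
    simp [pairsBelow, List.length_flatMap]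
  · refine Sigma.ext rfl (heq_of_eq (SimpleGraph.ext ?_))
    funext i j
    have hmem : ∀ i j : Fin m, ((i : ℕ), (j : ℕ)) ∈ E ↔ F.Adj i j := by
      intro i j
      simp [E, mem_pairsBelow]
    simp only [graphOfCode, hmem, eq_iff_iff]
    constructor
    · rintro ⟨-, h | h⟩
      · exact h
      · exact h.symm
    · intro h
      exact ⟨h.ne, Or.inl h⟩

end MinorStream

namespace MinorStream

open SimpleGraph

theorem MinorIn.card_le {m n : ℕ} {F : SimpleGraph (Fin m)} {G : SimpleGraph (Fin n)}
    {s : Set (Fin n)} (h : MinorIn F G s) : m ≤ n := by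
  obtain ⟨B, -, hc, hd, -⟩ := h
  have hne : ∀ a, ∃ x, x ∈ B a := fun a => Set.nonempty_coe_sort.1 (hc a).nonempty
  choose x hx using hne
  have hinj : Function.Injective x := by
    intro a b hab
    by_contra hne
    refine Set.disjoint_left.1 (hd a b hne) (hx a) ?_
    rw [hab]
    exact hx b
  simpa using Fintype.card_le_of_injective _ hinj

/-- The test that is carried out after the end of the stream is correct for the stored graph. -/
theorem any_minorLists_iff {𝓕 : Set FinGraph} {inFamily : ℕ × Store → Bool}
    (hfam : ∀ c, inFamily c = true ↔ graphOfCode c ∈ 𝓕) {n k : ℕ} {Q : Store} :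
    ((minorLists n k Q).any fun cs => cs.all fun c => !inFamily c) = true ↔
      ∃ X : Finset (Fin n), X.card ≤ k ∧
        ∀ F ∈ 𝓕, ¬ MinorIn F.2 (graphOfCode (n, Q)).2 {v : Fin n | v ∉ X} := by
  rw [List.any_eq_true]
  constructor
  · rintro ⟨cs, hcs, hall⟩
    obtain ⟨X, hX, rfl⟩ := List.mem_map.1 hcs
    rw [mem_listsUpTo] at hX
    refine ⟨Finset.univ.filter fun v : Fin n => (v : ℕ) ∈ X, ?_, ?_⟩
    · refine le_trans ?_ ((List.toFinset_card_le X).trans hX.1)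
      refine Finset.card_le_card_of_injOn Fin.val ?_ Fin.val_injective.injOn
      intro v hv
      simpa using hv
    · intro F hF hmin
      -- Branch sets are disjoint and nonempty, so a minor has at most `n` vertices and the finite
      -- list of codes misses none.
      obtain ⟨c, hc, rfl⟩ := exists_mem_allCodes F (MinorIn.card_le hmin)
      have htest : minorTest n Q X c = true := by
        refine minorTest_of_minorIn ?_
        simpa using hmin
      have := List.all_eq_true.1 hall c (List.mem_filter.2 ⟨hc, htest⟩)
      rw [(hfam c).2 hF] at this
      exact absurd this (by simp)
  · rintro ⟨X, hX, hno⟩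
    refine ⟨_, List.mem_map.2 ⟨X.toList.map Fin.val, mem_listsUpTo.2 ⟨by simpa using hX, ?_⟩, rfl⟩,
      ?_⟩
    · intro a ha
      obtain ⟨v, -, rfl⟩ := List.mem_map.1 ha
      exact List.mem_range.2 v.2
    · rw [List.all_eq_true]
      intro c hc
      obtain ⟨-, hc⟩ := List.mem_filter.1 hc
      cases hb : inFamily c
      · rfl
      · refine absurd (minorIn_of_minorTest hc) ?_
        have := hno _ ((hfam c).1 hb)
        simpa [Fin.val_inj] using this

end MinorStream

/-! ### The invariant, and its preservation when an edge is revealed. -/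

namespace MinorStream

/-- The matched vertices. -/
def loops (P : Store) : Finset ℕ :=
  ((P.filter fun e => e.1 = e.2).map Prod.fst).toFinset

theorem mem_loops {P : Store} {a : ℕ} : a ∈ loops P ↔ (a, a) ∈ P := by
  simp only [loops, List.mem_toFinset, List.mem_map, List.mem_filter, decide_eq_true_eq]
  constructor
  · rintro ⟨⟨x, y⟩, ⟨h, hxy⟩, rfl⟩
    obtain rfl : x = y := hxy
    exact h
  · intro h
    exact ⟨(a, a), ⟨h, rfl⟩, rfl⟩

/-- The stored unmatched vertices other than `v` that are adjacent to all of `S`. -/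
def commonSet (n v : ℕ) (P : Store) (S : Finset ℕ) : Finset ℕ :=
  (Finset.range n).filter fun u => (u ≠ v ∧ (u, u) ∉ P) ∧ ∀ s ∈ S, (u, s) ∈ P

theorem mem_commonSet {n v u : ℕ} {P : Store} {S : Finset ℕ} :
    u ∈ commonSet n v P S ↔ u < n ∧ (u ≠ v ∧ (u, u) ∉ P) ∧ ∀ s ∈ S, (u, s) ∈ P := by
  simp [commonSet]

theorem countCommon_eq (n v : ℕ) (P : Store) (S : List ℕ) :
    countCommon n v P S = (commonSet n v P S.toFinset).card := by
  unfold countCommon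
  rw [← List.toFinset_card_of_nodup (List.nodup_range.filter _)]
  congr 1
  ext u
  simp [mem_commonSet]

theorem keepEdge_iff {n d N v b : ℕ} {P : Store} :
    keepEdge n d N v P b = true ↔ ∃ S : Finset ℕ, S.card ≤ d ∧ b ∈ S ∧ (∀ s ∈ S, (v, s) ∈ P) ∧
      (commonSet n v P S).card < N := by
  unfold keepEdge
  rw [List.any_eq_true]
  simp only [Bool.and_eq_true, List.all_eq_true, decide_eq_true_eq, Bool.not_eq_true',
    decide_eq_false_iff_not, not_le, mem_listsUpTo, countCommon_eq]
  constructor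
  · rintro ⟨S, ⟨h1, -⟩, ⟨h3, h4⟩, h5⟩
    exact ⟨S.toFinset, (List.toFinset_card_le S).trans h1, by simpa using h3, by simpa using h4, h5⟩
  · rintro ⟨S, h1, h2, h3, h4⟩
    refine ⟨S.toList, ⟨by simpa using h1, fun s hs => ?_⟩, ⟨by simpa using h2, by simpa using h3⟩,
      by simpa using h4⟩
    exact List.mem_map.2 ⟨(v, s), h3 s (by simpa using hs), rfl⟩

theorem mem_finalize {n d N v : ℕ} {P : Store} {e : ℕ × ℕ} :
    e ∈ finalize n d N v P ↔
      e ∈ P ∧ (((v, v) ∈ P ∨ e.1 ≠ v) ∨ keepEdge n d N v P e.2 = true) := by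
  simp [finalize, List.mem_filter]

/-- The state of the algorithm when the vertices in `D` have been exposed completely, and the
edges from `v` to `L` have been revealed. -/
structure Invariant (n d N : ℕ) (R : ℕ → ℕ → Prop) (D : Set ℕ) (v : ℕ) (L : Set ℕ)
    (P : Store) : Prop where
  nodup : P.Nodup
  loop_lt : ∀ a, (a, a) ∈ P → a < n
  edge : ∀ a b, (a, b) ∈ P → a ≠ b → R a b ∧ (a ∈ D ∨ a = v) ∧ (b, b) ∈ P
  -- The trace of the matching: a cover contains an end of every matching edge, although only the
  -- matched vertices are marked.
  half : ∀ C : Finset ℕ, (∀ a b, R a b → a ∈ C ∨ b ∈ C) →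
    (loops P).card ≤ 2 * (loops P ∩ C).card
  nbr : ∀ u ∈ D, (u, u) ∉ P → ∀ w, R u w → (w, w) ∈ P
  matched : ∀ u ∈ D, ∀ w ∈ D, (u, u) ∈ P → (w, w) ∈ P → R u w → (u, w) ∈ P ∨ (w, u) ∈ P
  common : ∀ u ∈ D, (u, u) ∉ P → ∀ S : Finset ℕ, S.Nonempty → S.card ≤ d → (∀ s ∈ S, R u s) →
    (∀ s ∈ S, (u, s) ∈ P) ∨ N ≤ (commonSet n v P S).card
  -- `T S` collects the vertices whose edges are charged to `S`. It serves only the counting and is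
  -- not part of the memory.
  sparse : ∃ T : Finset ℕ → Finset ℕ, (∀ S, (T S).card ≤ N) ∧
    (∀ S, ∀ u ∈ T S, u ∈ D ∧ u ∈ commonSet n v P S) ∧
    ∀ u s, (u, s) ∈ P → u ≠ v → (u, u) ∉ P → ∃ S, s ∈ S ∧ S.card ≤ d ∧ u ∈ T S
  seen : ∀ b, (v, b) ∈ P → b ≠ v → b ∈ L
  seen_unmatched : (v, v) ∉ P → ∀ b ∈ L, (v, b) ∈ P
  -- The exposure of `b` is over, so this is the last time that the edge is revealed.
  seen_matched : ∀ b ∈ L, b ∈ D → (b, b) ∈ P → (v, b) ∈ P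

theorem Invariant.nil (n d N : ℕ) (R : ℕ → ℕ → Prop) (v : ℕ) :
    Invariant n d N R ∅ v ∅ [] where
  nodup := List.nodup_nil
  loop_lt := by simp
  edge := by simp
  half := by simp [loops]
  nbr := by simp
  matched := by simp
  common := by simp
  sparse := ⟨fun _ => ∅, by simp, by simp, by simp⟩
  seen := by simp
  seen_unmatched := by simp
  seen_matched := by simp

section Steps

variable {n d N : ℕ} {R : ℕ → ℕ → Prop} {D : Set ℕ} {v : ℕ} {L : Set ℕ} {P : Store}

/-- Adding pairs with first component `v` to the store. -/
theorem Invariant.cons_edge (h : Invariant n d N R D v L P) (hirr : ∀ a, ¬ R a a)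
    (hvD : v ∉ D) {w : ℕ} (hvw : R v w) (hwL : w ∉ L) (hw : (w, w) ∈ P) :
    Invariant n d N R D v (insert w L) ((v, w) :: P) := by
  have hne : v ≠ w := by
    rintro rfl
    exact hirr v hvw
  have hloop : ∀ a, (a, a) ∈ (v, w) :: P ↔ (a, a) ∈ P := by
    intro a
    rw [List.mem_cons, or_iff_right]
    intro e
    rw [Prod.mk.injEq] at e
    exact hne (e.1.symm.trans e.2)
  have hoff : ∀ u s, u ≠ v → ((u, s) ∈ (v, w) :: P ↔ (u, s) ∈ P) := by
    intro u s hu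
    rw [List.mem_cons, or_iff_right]
    intro e
    rw [Prod.mk.injEq] at e
    exact hu e.1
  have hloops : loops ((v, w) :: P) = loops P := by
    ext a
    rw [mem_loops, mem_loops, hloop]
  have hDv : ∀ u ∈ D, u ≠ v := fun u hu e => hvD (e ▸ hu)
  have hcommon : ∀ S, commonSet n v ((v, w) :: P) S = commonSet n v P S := by
    intro S
    ext u
    rw [mem_commonSet, mem_commonSet, hloop]
    by_cases hu : u = v
    · simp [hu]
    · simp only [hoff u _ hu]
  refine ⟨?_, ?_, ?_, ?_, ?_, ?_, ?_, ?_, ?_, ?_, ?_⟩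
  · exact List.nodup_cons.2 ⟨fun hm => hwL (h.seen w hm hne.symm), h.nodup⟩
  · intro a ha
    exact h.loop_lt a ((hloop a).1 ha)
  · intro a b hab hne'
    rw [hloop]
    obtain e | hab := List.mem_cons.1 hab
    · rw [Prod.mk.injEq] at e
      obtain ⟨rfl, rfl⟩ := e
      exact ⟨hvw, Or.inr rfl, hw⟩
    · exact h.edge a b hab hne'
  · rw [hloops]
    exact h.half
  · intro u hu huP w' hw'
    rw [hloop] at huP ⊢
    exact h.nbr u hu huP w' hw'
  · intro u hu w' hw' h1 h2 h3
    rw [hloop] at h1 h2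
    exact (h.matched u hu w' hw' h1 h2 h3).imp (List.mem_cons_of_mem _) (List.mem_cons_of_mem _)
  · intro u hu huP S hS hSd hSR
    rw [hloop] at huP
    rw [hcommon]
    exact (h.common u hu huP S hS hSd hSR).imp
      (fun h' s hs => List.mem_cons_of_mem _ (h' s hs)) id
  · obtain ⟨T, hT1, hT2, hT3⟩ := h.sparse
    refine ⟨T, hT1, fun S u hu => ?_, fun u s hus huv huP => ?_⟩
    · rw [hcommon]
      exact hT2 S u hu
    · rw [hloop] at huP
      rw [hoff u s huv] at hus
      exact hT3 u s hus huv huP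
  · intro b hb hbv
    obtain e | hb := List.mem_cons.1 hb
    · rw [Prod.mk.injEq] at e
      exact Or.inl e.2
    · exact Or.inr (h.seen b hb hbv)
  · intro hv b hb
    rw [hloop] at hv
    obtain rfl | hb := hb
    · exact List.mem_cons_self
    · exact List.mem_cons_of_mem _ (h.seen_unmatched hv b hb)
  · intro b hb hbD hbP
    rw [hloop] at hbP
    obtain rfl | hb := hb
    · exact List.mem_cons_self
    · exact List.mem_cons_of_mem _ (h.seen_matched b hb hbD hbP)

/-- Matching the current vertex `v` with an unmatched neighbour. -/
theorem Invariant.cons_loops (h : Invariant n d N R D v L P)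
    (hlt : ∀ a b, R a b → a < n ∧ b < n) (hirr : ∀ a, ¬ R a a) (hvD : v ∉ D) {w : ℕ}
    (hvw : R v w) (hwD : w ∉ D) (hv : (v, v) ∉ P) (hw : (w, w) ∉ P) :
    Invariant n d N R D v L ((v, v) :: (w, w) :: P) := by
  have hne : v ≠ w := by
    rintro rfl
    exact hirr v hvw
  have hloop : ∀ a, (a, a) ∈ (v, v) :: (w, w) :: P ↔ a = v ∨ a = w ∨ (a, a) ∈ P := by
    intro a
    simp [List.mem_cons]
  have hoff : ∀ u s, u ≠ s → ((u, s) ∈ (v, v) :: (w, w) :: P ↔ (u, s) ∈ P) := by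
    intro u s hu
    simp only [List.mem_cons, Prod.mk.injEq]
    constructor
    · rintro (⟨rfl, rfl⟩ | ⟨rfl, rfl⟩ | h')
      · exact absurd rfl hu
      · exact absurd rfl hu
      · exact h'
    · exact fun h' => Or.inr (Or.inr h')
  have hmem : ∀ e ∈ P, e ∈ (v, v) :: (w, w) :: P := fun e he =>
    List.mem_cons_of_mem _ (List.mem_cons_of_mem _ he)
  have hloopD : ∀ u ∈ D, ((u, u) ∈ (v, v) :: (w, w) :: P ↔ (u, u) ∈ P) := by
    intro u hu
    rw [hloop]
    constructor
    · rintro (rfl | rfl | h')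
      · exact absurd hu hvD
      · exact absurd hu hwD
      · exact h'
    · exact fun h' => Or.inr (Or.inr h')
  have hloops : loops ((v, v) :: (w, w) :: P) = insert v (insert w (loops P)) := by
    ext a
    simp only [mem_loops, hloop, Finset.mem_insert]
  have hcommon : ∀ S, ∀ u ∈ D, u ∈ commonSet n v P S →
      u ∈ commonSet n v ((v, v) :: (w, w) :: P) S := by
    intro S u hu hmemu
    rw [mem_commonSet] at hmemu ⊢
    exact ⟨hmemu.1, ⟨hmemu.2.1.1, by rw [hloopD u hu]; exact hmemu.2.1.2⟩,
      fun s hs => hmem _ (hmemu.2.2 s hs)⟩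
  -- Recorded common neighbours are already exposed, hence they are not affected by the matching of
  -- `v` and `w`.
  have hcommonD : ∀ S : Finset ℕ, S.Nonempty → ∀ u ∈ commonSet n v P S, u ∈ D := by
    rintro S ⟨s, hs⟩ u hu
    rw [mem_commonSet] at hu
    have hus : u ≠ s := by
      rintro rfl
      exact hu.2.1.2 (hu.2.2 u hs)
    exact (h.edge u s (hu.2.2 s hs) hus).2.1.resolve_right hu.2.1.1
  refine ⟨?_, ?_, ?_, ?_, ?_, ?_, ?_, ?_, ?_, ?_, ?_⟩
  · simp [h.nodup, hv, hw, hne]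
  · intro a ha
    obtain rfl | rfl | ha := (hloop a).1 ha
    · exact (hlt _ _ hvw).1
    · exact (hlt _ _ hvw).2
    · exact h.loop_lt a ha
  · intro a b hab hne'
    rw [hoff a b hne'] at hab
    obtain ⟨h1, h2, h3⟩ := h.edge a b hab hne'
    exact ⟨h1, h2, hmem _ h3⟩
  · intro C hC
    have hvl : v ∉ insert w (loops P) := by
      simp [mem_loops, hv, hne]
    have hwl : w ∉ loops P := by
      simp [mem_loops, hw]
    have h1 := h.half C hC
    rw [hloops, Finset.card_insert_of_notMem hvl, Finset.card_insert_of_notMem hwl]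
    -- Two vertices become matched, and `C` contains one of them because it covers the edge `v w`.
    have h2 : (loops P ∩ C).card + 1 ≤ (insert v (insert w (loops P)) ∩ C).card := by
      obtain hvC | hwC := hC v w hvw
      · rw [← Finset.card_insert_of_notMem (a := v) (s := loops P ∩ C)
          (by simp [mem_loops, hv])]
        refine Finset.card_le_card ?_
        intro x
        simp only [Finset.mem_insert, Finset.mem_inter]
        rintro (rfl | hx)
        · exact ⟨Or.inl rfl, hvC⟩
        · exact ⟨Or.inr (Or.inr hx.1), hx.2⟩
      · rw [← Finset.card_insert_of_notMem (a := w) (s := loops P ∩ C)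
          (by simp [mem_loops, hw])]
        refine Finset.card_le_card ?_
        intro x
        simp only [Finset.mem_insert, Finset.mem_inter]
        rintro (rfl | hx)
        · exact ⟨Or.inr (Or.inl rfl), hwC⟩
        · exact ⟨Or.inr (Or.inr hx.1), hx.2⟩
    omega
  · intro u hu huP w' hw'
    rw [hloopD u hu] at huP
    exact hmem _ (h.nbr u hu huP w' hw')
  · intro u hu w' hw' h1 h2 h3
    rw [hloopD _ hu] at h1
    rw [hloopD _ hw'] at h2
    exact (h.matched u hu w' hw' h1 h2 h3).imp (hmem _) (hmem _)
  · intro u hu huP S hS hSd hSR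
    rw [hloopD u hu] at huP
    refine (h.common u hu huP S hS hSd hSR).imp (fun h' s hs => hmem _ (h' s hs)) fun h' =>
      h'.trans (Finset.card_le_card fun x hx => hcommon S x (hcommonD S hS x hx) hx)
  · obtain ⟨T, hT1, hT2, hT3⟩ := h.sparse
    refine ⟨T, hT1, fun S u hu => ?_, fun u s hus huv huP => ?_⟩
    · obtain ⟨h1, h2⟩ := hT2 S u hu
      exact ⟨h1, hcommon S u h1 h2⟩
    · have hus' : u ≠ s := by
        rintro rfl
        exact huP hus
      rw [hoff u s hus'] at hus
      exact hT3 u s hus huv fun h' => huP (hmem _ h')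
  · intro b hb hbv
    rw [hoff v b hbv.symm] at hb
    exact h.seen b hb hbv
  · intro hv'
    exact absurd List.mem_cons_self hv'
  · intro b hb hbD hbP
    rw [hloopD b hbD] at hbP
    exact hmem _ (h.seen_matched b hb hbD hbP)

theorem Invariant.addEdge (h : Invariant n d N R D v L P)
    (hlt : ∀ a b, R a b → a < n ∧ b < n) (hsymm : ∀ a b, R a b → R b a) (hirr : ∀ a, ¬ R a a)
    (hvD : v ∉ D) {w : ℕ} (hvw : R v w) (hwL : w ∉ L) :
    Invariant n d N R D v (insert w L) (addEdge v w P) := by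
  unfold MinorStream.addEdge
  by_cases hw : (w, w) ∈ P
  · rw [decide_eq_true hw]
    exact h.cons_edge hirr hvD hvw hwL hw
  rw [decide_eq_false hw]
  by_cases hv : (v, v) ∈ P
  · rw [decide_eq_true hv]
    -- The edge is discarded here. No obligation arises, since `w` is unmatched and `v` is matched.
    refine { h with seen := ?_, seen_unmatched := ?_, seen_matched := ?_ }
    · exact fun b hb hbv => Or.inr (h.seen b hb hbv)
    · exact fun hv' => absurd hv hv'
    · rintro b (rfl | hb) hbD hbP
      · exact absurd hbP hw
      · exact h.seen_matched b hb hbD hbP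
  · rw [decide_eq_false hv]
    -- All neighbours of an exposed unmatched vertex are matched, so such a vertex stays unmatched
    -- for ever.
    have hwD : w ∉ D := fun hwD => hv (h.nbr w hwD hw v (hsymm _ _ hvw))
    exact (h.cons_loops hlt hirr hvD hvw hwD hv hw).cons_edge hirr hvD hvw hwL
      (List.mem_cons_of_mem _ List.mem_cons_self)

end Steps

end MinorStream

/-! ### The end of an exposure, and runs over a whole stream. -/

namespace MinorStream

variable {n d N : ℕ} {R : ℕ → ℕ → Prop} {D : Set ℕ} {v : ℕ} {L : Set ℕ} {P : Store}

/-- A previously exposed vertex has the same stored neighbours before and after the cleaning up. -/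
theorem mem_finalize_of_ne {u s : ℕ} (hu : u ≠ v) : (u, s) ∈ finalize n d N v P ↔ (u, s) ∈ P := by
  rw [mem_finalize]
  exact and_iff_left (Or.inl (Or.inr hu))

theorem loop_mem_finalize {a : ℕ} : (a, a) ∈ finalize n d N v P ↔ (a, a) ∈ P := by
  rw [mem_finalize]
  refine and_iff_left_of_imp fun h => Or.inl ?_
  by_cases hav : a = v
  · exact Or.inl (hav ▸ h)
  · exact Or.inr hav

theorem finalize_eq_self (hv : (v, v) ∈ P) : finalize n d N v P = P := by
  simp [finalize, hv]

theorem Invariant.finalize_matched (h : Invariant n d N R D v {w | R v w} P)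
    (hsymm : ∀ a b, R a b → R b a) (hvD : v ∉ D) (hv : (v, v) ∈ P) {v' : ℕ}
    (hv' : v' ∉ insert v D) : Invariant n d N R (insert v D) v' ∅ P := by
  have hv'v : v' ≠ v := fun e => hv' (Or.inl e)
  have hv'D : v' ∉ D := fun e => hv' (Or.inr e)
  have hcommonD : ∀ S : Finset ℕ, S.Nonempty → commonSet n v P S ⊆ commonSet n v' P S := by
    rintro S ⟨s, hs⟩ u hu
    rw [mem_commonSet] at hu ⊢
    have hus : u ≠ s := by
      rintro rfl
      exact hu.2.1.2 (hu.2.2 u hs)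
    refine ⟨hu.1, ⟨?_, hu.2.1.2⟩, hu.2.2⟩
    rintro rfl
    exact hv'D ((h.edge _ _ (hu.2.2 s hs) hus).2.1.resolve_right hu.2.1.1)
  have hno : ∀ b, (v', b) ∈ P → b = v' := by
    intro b hb
    by_contra hne
    exact hv' ((h.edge v' b hb (Ne.symm hne)).2.1.elim Or.inr Or.inl)
  refine ⟨h.nodup, h.loop_lt, ?_, h.half, ?_, ?_, ?_, ?_, ?_, by simp, by simp⟩
  · intro a b hab hne
    obtain ⟨h1, h2, h3⟩ := h.edge a b hab hne
    exact ⟨h1, Or.inl (h2.elim Or.inr Or.inl), h3⟩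
  · rintro u (rfl | hu) huP
    · exact absurd hv huP
    · exact h.nbr u hu huP
  · rintro u (rfl | hu) w (rfl | hw) h1 h2 h3
    · exact Or.inl h1
    · exact Or.inl (h.seen_matched w h3 hw h2)
    · exact Or.inr (h.seen_matched u (hsymm _ _ h3) hu h1)
    · exact h.matched u hu w hw h1 h2 h3
  · rintro u (rfl | hu) huP S hS hSd hSR
    · exact absurd hv huP
    · exact (h.common u hu huP S hS hSd hSR).imp id
        fun h' => h'.trans (Finset.card_le_card (hcommonD S hS))
  · obtain ⟨T, hT1, hT2, hT3⟩ := h.sparse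
    refine ⟨T, hT1, fun S u hu => ?_, fun u s hus huv huP => ?_⟩
    · obtain ⟨h1, h2⟩ := hT2 S u hu
      rw [mem_commonSet] at h2 ⊢
      refine ⟨Or.inr h1, h2.1, ⟨?_, h2.2.1.2⟩, h2.2.2⟩
      rintro rfl
      exact hv'D h1
    · refine hT3 u s hus ?_ huP
      rintro rfl
      exact huP hv
  · intro b hb hne
    exact absurd (hno b hb) hne

theorem Invariant.finalize_unmatched (h : Invariant n d N R D v {w | R v w} P)
    (hlt : ∀ a b, R a b → a < n ∧ b < n) (hvD : v ∉ D) (hv : (v, v) ∉ P) {v' : ℕ}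
    (hv' : v' ∉ insert v D) :
    Invariant n d N R (insert v D) v' ∅ (finalize n d N v P) := by
  classical
  have hv'v : v' ≠ v := fun e => hv' (Or.inl e)
  have hv'D : v' ∉ D := fun e => hv' (Or.inr e)
  have hDv : ∀ u ∈ D, u ≠ v := fun u hu e => hvD (e ▸ hu)
  have hsub : ∀ e, e ∈ finalize n d N v P → e ∈ P := fun e he => (mem_finalize.1 he).1
  have hloops : loops (finalize n d N v P) = loops P := by
    ext a
    rw [mem_loops, mem_loops, loop_mem_finalize]
  have hne : ∀ {u s}, (u, u) ∉ P → (u, s) ∈ P → u ≠ s := by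
    rintro u s hu hus rfl
    exact hu hus
  have hcommonD : ∀ S : Finset ℕ, S.Nonempty →
      commonSet n v P S ⊆ commonSet n v' (finalize n d N v P) S := by
    rintro S ⟨s, hs⟩ u hu
    rw [mem_commonSet] at hu ⊢
    rw [loop_mem_finalize]
    refine ⟨hu.1, ⟨?_, hu.2.1.2⟩, fun t ht => (mem_finalize_of_ne hu.2.1.1).2 (hu.2.2 t ht)⟩
    rintro rfl
    exact hv'D ((h.edge _ _ (hu.2.2 s hs) (hne hu.2.1.2 (hu.2.2 s hs))).2.1.resolve_right hu.2.1.1)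
  -- The edges to `S` survive together, because the same `S` justifies keeping each of them; the
  -- test refers to the store before filtering.
  have hkeep : ∀ S : Finset ℕ, S.card ≤ d → (∀ s ∈ S, (v, s) ∈ P) →
      (commonSet n v P S).card < N → ∀ s ∈ S, (v, s) ∈ finalize n d N v P := by
    intro S h1 h2 h3 s hs
    exact mem_finalize.2 ⟨h2 s hs, Or.inr (keepEdge_iff.2 ⟨S, h1, hs, h2, h3⟩)⟩
  refine ⟨h.nodup.filter _, ?_, ?_, ?_, ?_, ?_, ?_, ?_, ?_, by simp, by simp⟩
  · intro a ha
    exact h.loop_lt a (hsub _ ha)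
  · intro a b hab hab'
    obtain ⟨h1, h2, h3⟩ := h.edge a b (hsub _ hab) hab'
    exact ⟨h1, Or.inl (h2.elim Or.inr Or.inl), loop_mem_finalize.2 h3⟩
  · rw [hloops]
    exact h.half
  · rintro u (rfl | hu) huP w hw
    · have hw' := h.seen_unmatched hv w hw
      exact loop_mem_finalize.2 (h.edge u w hw' (hne hv hw')).2.2
    · rw [loop_mem_finalize] at huP ⊢
      exact h.nbr u hu huP w hw
  · rintro u hu w hw h1 h2 h3
    rw [loop_mem_finalize] at h1 h2
    have huv : u ≠ v := by
      rintro rfl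
      exact hv h1
    have hwv : w ≠ v := by
      rintro rfl
      exact hv h2
    rw [mem_finalize_of_ne huv, mem_finalize_of_ne hwv]
    exact h.matched u (hu.resolve_left huv) w (hw.resolve_left hwv) h1 h2 h3
  · rintro u (rfl | hu) huP S hS hSd hSR
    · have hSP : ∀ s ∈ S, (u, s) ∈ P := fun s hs => h.seen_unmatched hv s (hSR s hs)
      by_cases hc : (commonSet n u P S).card < N
      · exact Or.inl (hkeep S hSd hSP hc)
      · exact Or.inr ((not_lt.1 hc).trans (Finset.card_le_card (hcommonD S hS)))
    · rw [loop_mem_finalize] at huP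
      refine (h.common u hu huP S hS hSd hSR).imp
        (fun h' s hs => (mem_finalize_of_ne (hDv u hu)).2 (h' s hs))
        fun h' => h'.trans (Finset.card_le_card (hcommonD S hS))
  · obtain ⟨T, hT1, hT2, hT3⟩ := h.sparse
    let Small : Finset ℕ → Prop := fun S => S.Nonempty ∧ S.card ≤ d ∧ (∀ s ∈ S, (v, s) ∈ P) ∧
      (commonSet n v P S).card < N
    have hTsub : ∀ S, T S ⊆ commonSet n v P S := fun S u hu => (hT2 S u hu).2
    -- `v` is charged to every nonempty `S` that causes edges at `v` to be kept. There is room for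
    -- it: `T S` lies in the common neighbourhood, which had fewer than `N` elements.
    refine ⟨fun S => if Small S then insert v (T S) else T S, fun S => ?_, fun S u hu => ?_,
      fun u s hus huv huP => ?_⟩
    · by_cases hS : Small S
      · simp only [if_pos hS]
        refine (Finset.card_insert_le _ _).trans ?_
        exact Nat.succ_le_of_lt (lt_of_le_of_lt (Finset.card_le_card (hTsub S)) hS.2.2.2)
      · simp only [if_neg hS]
        exact hT1 S
    · have hold : u ∈ T S → u ∈ insert v D ∧ u ∈ commonSet n v' (finalize n d N v P) S := by
        intro hu
        obtain ⟨h1, h2⟩ := hT2 S u hu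
        rw [mem_commonSet] at h2 ⊢
        rw [loop_mem_finalize]
        refine ⟨Or.inr h1, h2.1, ⟨?_, h2.2.1.2⟩,
          fun t ht => (mem_finalize_of_ne h2.2.1.1).2 (h2.2.2 t ht)⟩
        rintro rfl
        exact hv'D h1
      by_cases hS : Small S
      · simp only [if_pos hS] at hu
        obtain rfl | hu := Finset.mem_insert.1 hu
        · obtain ⟨⟨s, hs⟩, hSd, hSP, hc⟩ := hS
          refine ⟨Or.inl rfl, mem_commonSet.2 ⟨?_, ⟨hv'v.symm, ?_⟩, hkeep S hSd hSP hc⟩⟩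
          · exact (hlt _ _ (h.edge u s (hSP s hs) (hne hv (hSP s hs))).1).1
          · rw [loop_mem_finalize]
            exact hv
        · exact hold hu
      · simp only [if_neg hS] at hu
        exact hold hu
    · rw [loop_mem_finalize] at huP
      by_cases huv' : u = v
      · subst huv'
        obtain ⟨h1, (h2 | h2) | h2⟩ := mem_finalize.1 hus
        · exact absurd h2 hv
        · exact absurd rfl h2
        · obtain ⟨S, hSd, hs, hSP, hc⟩ := keepEdge_iff.1 h2
          refine ⟨S, hs, hSd, ?_⟩
          simp only [if_pos (show Small S from ⟨⟨s, hs⟩, hSd, hSP, hc⟩)]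
          exact Finset.mem_insert_self _ _
      · obtain ⟨S, hs, hSd, hu⟩ := hT3 u s (hsub _ hus) huv' huP
        refine ⟨S, hs, hSd, ?_⟩
        dsimp only
        split_ifs
        · exact Finset.mem_insert_of_mem hu
        · exact hu
  · intro b hb hne'
    exact absurd ((h.edge v' b (hsub _ hb) (Ne.symm hne')).2.1.elim Or.inr Or.inl) hv'

/-- The invariant is preserved when the exposure of a vertex ends. -/
theorem Invariant.finalize (h : Invariant n d N R D v {w | R v w} P)
    (hlt : ∀ a b, R a b → a < n ∧ b < n) (hsymm : ∀ a b, R a b → R b a) (hvD : v ∉ D)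
    {v' : ℕ} (hv' : v' ∉ insert v D) :
    Invariant n d N R (insert v D) v' ∅ (finalize n d N v P) := by
  by_cases hv : (v, v) ∈ P
  · rw [finalize_eq_self hv]
    exact h.finalize_matched hsymm hvD hv hv'
  · exact h.finalize_unmatched hlt hvD hv hv'

section Runs

variable {α β : Type*}

/-- `Q` holds for all states that are passed when `f` is applied successively. -/
def AllStates (f : α → β → α) (Q : α → Prop) : α → List β → Prop
  | s, [] => Q s
  | s, t :: l => Q s ∧ AllStates f Q (f s t) l

theorem AllStates.append {f : α → β → α} {Q : α → Prop} {s : α} {l l' : List β}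
    (h : AllStates f Q s l) (h' : AllStates f Q (l.foldl f s) l') :
    AllStates f Q s (l ++ l') := by
  induction l generalizing s with
  | nil => exact h'
  | cons t l ih => exact ⟨h.1, ih h.2 h'⟩

theorem AllStates.take {f : α → β → α} {Q : α → Prop} {s : α} {l : List β}
    (h : AllStates f Q s l) (i : ℕ) : Q ((l.take i).foldl f s) := by
  induction l generalizing s i with
  | nil =>
    rw [List.take_nil]
    exact h
  | cons t l ih =>
    cases i with
    | zero => exact h.1
    | succ i => exact ih h.2 i

end Runs

/-- What is known about every state of the algorithm. -/
def GoodState (n d N : ℕ) (R : ℕ → ℕ → Prop) (s : ℕ × Store) : Prop :=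
  s.1 ≤ n ∧ ∃ D L, Invariant n d N R D s.1 L s.2

theorem foldl_edges (hlt : ∀ a b, R a b → a < n ∧ b < n) (hsymm : ∀ a b, R a b → R b a)
    (hirr : ∀ a, ¬ R a a) (hvD : v ∉ D) (hvn : v ≤ n) (l : List ℕ) (hl : l.Nodup)
    (hlR : ∀ w ∈ l, R v w) (h : Invariant n d N R D v L P) (hL : ∀ w ∈ l, w ∉ L) :
    AllStates (stepStore n d N) (GoodState n d N R) (v, P)
        (l.map fun w => (Sum.inr (v, w) : ALToken)) ∧
      ∃ P', (l.map fun w => (Sum.inr (v, w) : ALToken)).foldl (stepStore n d N) (v, P) = (v, P') ∧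
        Invariant n d N R D v (L ∪ {w | w ∈ l}) P' := by
  induction l generalizing L P with
  | nil => exact ⟨⟨hvn, D, L, h⟩, P, rfl, by simpa using h⟩
  | cons w l ih =>
    have hw := h.addEdge hlt hsymm hirr hvD (hlR w List.mem_cons_self) (hL w List.mem_cons_self)
    rw [List.nodup_cons] at hl
    obtain ⟨h1, P', h2, h3⟩ := ih hl.2 (fun x hx => hlR x (List.mem_cons_of_mem _ hx)) hw (by
      rintro x hx (rfl | hx')
      · exact hl.1 hx
      · exact hL x (List.mem_cons_of_mem _ hx) hx')
    refine ⟨⟨⟨hvn, D, L, h⟩, h1⟩, P', h2, ?_⟩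
    convert h3 using 1
    ext x
    simp only [Set.mem_union, Set.mem_insert_iff, Set.mem_ofPred_eq, List.mem_cons]
    tauto

/-- The cleaning up after a vertex is triggered only by the next announcement. The induction
therefore speaks of the finalized store, with an arbitrary vertex `v'` not yet exposed as the
current one. -/
theorem foldl_blocks (hlt : ∀ a b, R a b → a < n ∧ b < n) (hsymm : ∀ a b, R a b → R b a)
    (hirr : ∀ a, ¬ R a a) (nbr : ℕ → List ℕ) (order : List ℕ) (ho : order.Nodup)
    (hn : ∀ v ∈ order, v < n ∧ (nbr v).Nodup ∧ ∀ w, w ∈ nbr v ↔ R v w) (hD : ∀ v ∈ order, v ∉ D)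
    {s : ℕ × Store} (hs : GoodState n d N R s)
    (hinv : ∀ v' ∉ D, Invariant n d N R D v' ∅ (finalize n d N s.1 s.2)) :
    let σ := order.flatMap fun v =>
      (Sum.inl v : ALToken) :: (nbr v).map fun w => (Sum.inr (v, w) : ALToken)
    AllStates (stepStore n d N) (GoodState n d N R) s σ ∧
      ∀ v' ∉ D ∪ {v | v ∈ order}, Invariant n d N R (D ∪ {v | v ∈ order}) v' ∅
        (finalize n d N (σ.foldl (stepStore n d N) s).1 (σ.foldl (stepStore n d N) s).2) := by
  induction order generalizing D s with
  | nil => exact ⟨hs, by simpa using hinv⟩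
  | cons v order ih =>
    intro σ
    rw [List.nodup_cons] at ho
    obtain ⟨hvn, hnd, hmem⟩ := hn v List.mem_cons_self
    have hvD : v ∉ D := hD v List.mem_cons_self
    obtain ⟨h1, P', h2, h3⟩ := foldl_edges hlt hsymm hirr hvD hvn.le (nbr v) hnd
      (fun w hw => (hmem w).1 hw) (hinv v hvD) (by simp)
    have hL : (∅ ∪ {w | w ∈ nbr v} : Set ℕ) = {w | R v w} := by
      ext w
      simp [hmem]
    rw [hL] at h3
    have hDv : D ∪ {x | x ∈ v :: order} = insert v D ∪ {x | x ∈ order} := by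
      ext x
      simp only [Set.mem_union, Set.mem_insert_iff, Set.mem_ofPred_eq, List.mem_cons]
      tauto
    obtain ⟨h4, h5⟩ := ih (D := insert v D) (s := (v, P')) ho.2
      (fun x hx => hn x (List.mem_cons_of_mem _ hx))
      (by
        rintro x hx (rfl | hx')
        · exact ho.1 hx
        · exact hD x (List.mem_cons_of_mem _ hx) hx')
      ⟨hvn.le, D, _, h3⟩ (fun v' hv' => h3.finalize hlt hsymm hvD hv')
    have hblock : ((Sum.inl v : ALToken) :: (nbr v).map fun w => (Sum.inr (v, w) : ALToken)).foldl
        (stepStore n d N) s = (v, P') := h2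
    have hσ : σ = ((Sum.inl v : ALToken) :: (nbr v).map fun w => (Sum.inr (v, w) : ALToken)) ++
        order.flatMap fun v =>
          (Sum.inl v : ALToken) :: (nbr v).map fun w => (Sum.inr (v, w) : ALToken) := rfl
    rw [hσ, hDv, List.foldl_append, hblock]
    refine ⟨AllStates.append ⟨hs, h1⟩ ?_, h5⟩
    rw [hblock]
    exact h4

end MinorStream

/-! ### The space bound, and the transfer of minors to the stored graph. -/

namespace MinorStream

open SimpleGraph

section Size

/-- The sets of size `i ≤ d` contribute at most `(2K)^i / i! · i ≤ K^d · 4^i / i!`, and `∑ 4^i / i!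
≤ e^4 ≤ 3^4`. The factorial keeps the constant independent of `d`. -/
theorem sum_card_powerset_le {M : Finset ℕ} {d K : ℕ} (hM : M.card ≤ 2 * K) (hK : 1 ≤ K) :
    ∑ S ∈ M.powerset with S.card ≤ d, S.card ≤ 81 * K ^ d := by
  have h1 : ∑ S ∈ M.powerset with S.card ≤ d, S.card =
      ∑ i ∈ Finset.range (M.card + 1), M.card.choose i * if i ≤ d then i else 0 := by
    rw [Finset.sum_filter]
    have := Finset.sum_powerset_apply_card (fun i => if i ≤ d then i else 0) (x := M)
    simpa using this
  have hterm : ∀ i, ((M.card.choose i * if i ≤ d then i else 0 : ℕ) : ℝ) ≤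
      K ^ d * (4 ^ i / (i.factorial : ℝ)) := by
    intro i
    by_cases hi : i ≤ d
    · rw [if_pos hi, Nat.cast_mul]
      have h2 : (M.card.choose i : ℝ) ≤ (M.card : ℝ) ^ i / i.factorial := Nat.choose_le_pow_div i _
      have h3 : (M.card : ℝ) ^ i ≤ 2 ^ i * K ^ d := by
        have h4 : (M.card : ℝ) ≤ 2 * K := by exact_mod_cast hM
        have h5 : (1 : ℝ) ≤ K := by exact_mod_cast hK
        calc (M.card : ℝ) ^ i ≤ (2 * K) ^ i := by gcongr
          _ = 2 ^ i * K ^ i := mul_pow _ _ _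
          _ ≤ 2 ^ i * K ^ d := by gcongr
      have h6 : (i : ℝ) ≤ 2 ^ i := by exact_mod_cast Nat.lt_two_pow_self.le
      calc (M.card.choose i : ℝ) * i ≤ (2 ^ i * K ^ d / i.factorial) * 2 ^ i := by
            gcongr
            exact h2.trans (by gcongr)
        _ = K ^ d * (4 ^ i / i.factorial) := by
            rw [show (4 : ℝ) = 2 * 2 by norm_num, mul_pow]
            ring
    · rw [if_neg hi]
      simp only [mul_zero, Nat.cast_zero]
      positivity
  have hexp : Real.exp 4 ≤ 81 := by
    have h1 : Real.exp 4 = Real.exp 1 ^ 4 := by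
      rw [← Real.exp_nat_mul]
      norm_num
    have h2 : Real.exp 1 ≤ 3 := Real.exp_one_lt_d9.le.trans (by norm_num)
    rw [h1]
    calc Real.exp 1 ^ 4 ≤ 3 ^ 4 := by gcongr
      _ = 81 := by norm_num
  have : ((∑ S ∈ M.powerset with S.card ≤ d, S.card : ℕ) : ℝ) ≤ 81 * K ^ d := by
    rw [h1, Nat.cast_sum]
    calc _ ≤ ∑ i ∈ Finset.range (M.card + 1), (K : ℝ) ^ d * (4 ^ i / (i.factorial : ℝ)) :=
          Finset.sum_le_sum fun i _ => hterm i
      _ = K ^ d * ∑ i ∈ Finset.range (M.card + 1), 4 ^ i / (i.factorial : ℝ) := by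
          rw [Finset.mul_sum]
      _ ≤ K ^ d * 81 := by
          gcongr
          exact (Real.sum_le_exp_of_nonneg (by norm_num) _).trans hexp
      _ = 81 * K ^ d := mul_comm _ _
  exact_mod_cast this

variable {n d N : ℕ} {R : ℕ → ℕ → Prop} {D : Set ℕ} {v : ℕ} {L : Set ℕ} {P : Store}

theorem Invariant.card_loops_le (h : Invariant n d N R D v L P) {C : Finset ℕ} {K : ℕ}
    (hC : ∀ a b, R a b → a ∈ C ∨ b ∈ C) (hCK : C.card ≤ K) : (loops P).card ≤ 2 * K := by
  have h1 := h.half C hC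
  have h2 := Finset.card_le_card (Finset.inter_subset_right (s₁ := loops P) (s₂ := C))
  omega

/-- Second components are always matched. The three terms count the pairs whose first component is
matched, is the current vertex, or is an unmatched vertex charged to some `S`. -/
theorem Invariant.length_le (h : Invariant n d N R D v L P) :
    P.length ≤ (loops P).card * (loops P).card + (loops P).card +
      ∑ S ∈ (loops P).powerset with S.card ≤ d, N * S.card := by
  obtain ⟨T, hT1, hT2, hT3⟩ := h.sparse
  set M := loops P with hM
  have hsub : P.toFinset ⊆ (M ×ˢ M ∪ {v} ×ˢ M) ∪
      (M.powerset.filter fun S => S.card ≤ d).biUnion fun S => T S ×ˢ S := by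
    rintro ⟨u, s⟩ hus
    rw [List.mem_toFinset] at hus
    have hs : s ∈ M := by
      rw [hM, mem_loops]
      by_cases he : u = s
      · exact he ▸ hus
      · exact (h.edge u s hus he).2.2
    rw [Finset.mem_union, Finset.mem_union, Finset.mem_product, Finset.mem_product,
      Finset.mem_biUnion]
    by_cases hu : (u, u) ∈ P
    · exact Or.inl (Or.inl ⟨mem_loops.2 hu, hs⟩)
    by_cases huv : u = v
    · exact Or.inl (Or.inr ⟨Finset.mem_singleton.2 huv, hs⟩)
    obtain ⟨S, hsS, hSd, huT⟩ := hT3 u s hus huv hu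
    refine Or.inr ⟨S, Finset.mem_filter.2 ⟨Finset.mem_powerset.2 fun t ht => ?_, hSd⟩,
      Finset.mem_product.2 ⟨huT, hsS⟩⟩
    have hut := (mem_commonSet.1 (hT2 S u huT).2).2.2 t ht
    refine mem_loops.2 (h.edge u t hut ?_).2.2
    rintro rfl
    exact hu hut
  calc P.length = P.toFinset.card := (List.toFinset_card_of_nodup h.nodup).symm
    _ ≤ _ := Finset.card_le_card hsub
    _ ≤ _ := by
      refine (Finset.card_union_le _ _).trans (Nat.add_le_add ?_ ?_)
      · refine (Finset.card_union_le _ _).trans ?_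
        simp [Finset.card_product]
      · refine Finset.card_biUnion_le.trans (Finset.sum_le_sum fun S _ => ?_)
        rw [Finset.card_product]
        exact Nat.mul_le_mul_right _ (hT1 S)

/-- The number of common neighbours of a set that are to be stored. -/
def threshold (d K : ℕ) : ℕ :=
  K + 2 * d * K

theorem length_encodeState (s : ℕ × Store) : (encodeState s).length = 2 * s.2.length + 1 := by
  obtain ⟨v, P⟩ := s
  simp only [encodeState, List.length_cons]
  congr 1
  induction P with
  | nil => rfl
  | cons e P ih => simp only [List.flatMap_cons, List.length_append, ih]; simp; ring

theorem Invariant.length_encodeState_le {K : ℕ}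
    (h : Invariant n d (threshold d K) R D v L P) {C : Finset ℕ}
    (hC : ∀ a b, R a b → a ∈ C ∨ b ∈ C) (hCK : C.card ≤ K) (hd : 1 ≤ d) (hK : 1 ≤ K) :
    (encodeState (v, P)).length ≤ 499 * (d * K ^ (d + 1)) := by
  have hM := h.card_loops_le hC hCK
  have h1 := h.length_le
  rw [← Finset.mul_sum] at h1
  have h2 := sum_card_powerset_le (d := d) hM hK
  set m := (loops P).card
  set E := d * K ^ (d + 1) with hE
  have hKd : K ≤ K ^ d := Nat.le_self_pow (by omega) K
  have h3 : K * K ≤ E := by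
    rw [hE, pow_succ]
    calc K * K ≤ K ^ d * K := Nat.mul_le_mul_right _ hKd
      _ ≤ d * (K ^ d * K) := Nat.le_mul_of_pos_left _ hd
  have h4 : K ≤ K * K := Nat.le_mul_of_pos_left _ hK
  have h5 : threshold d K * (81 * K ^ d) ≤ 243 * E := by
    have : threshold d K ≤ 3 * (d * K) := by
      have : K ≤ d * K := Nat.le_mul_of_pos_left _ hd
      unfold threshold
      linarith
    calc threshold d K * (81 * K ^ d) ≤ 3 * (d * K) * (81 * K ^ d) := Nat.mul_le_mul_right _ this
      _ = 243 * E := by rw [hE, pow_succ]; ring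
  have h6 : m * m ≤ 4 * (K * K) := by
    calc m * m ≤ (2 * K) * (2 * K) := Nat.mul_le_mul hM hM
      _ = 4 * (K * K) := by ring
  have h7 := Nat.mul_le_mul_left (threshold d K) h2
  -- There are at most `(4 + 2 + 243) * E` pairs of two words each, plus one word for the current
  -- vertex: `2 * 249 + 1 = 499`.
  rw [length_encodeState]
  dsimp only
  omega

theorem Invariant.lt_of_mem_encodeState (h : Invariant n d N R D v L P)
    (hlt : ∀ a b, R a b → a < n ∧ b < n) {x : ℕ} (hx : x ∈ encodeState (v, P)) :
    x = v ∨ x < n := by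
  rw [encodeState, List.mem_cons, List.mem_flatMap] at hx
  refine hx.imp id ?_
  rintro ⟨⟨a, b⟩, hab, hx⟩
  have : a < n ∧ b < n := by
    by_cases he : a = b
    · subst he
      exact ⟨h.loop_lt a hab, h.loop_lt a hab⟩
    · exact hlt _ _ (h.edge a b hab he).1
  simp only [List.mem_cons, List.not_mem_nil, or_false] at hx
  obtain rfl | rfl := hx
  · exact this.1
  · exact this.2

end Size

/-- Adjacency in a graph on `Fin n`, as a relation on the natural numbers. -/
def valAdj {n : ℕ} (G : SimpleGraph (Fin n)) (a b : ℕ) : Prop :=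
  ∃ (ha : a < n) (hb : b < n), G.Adj ⟨a, ha⟩ ⟨b, hb⟩

/-- The graph on `Fin n` whose edges are the stored ones. -/
def storedGraph (n : ℕ) (Q : Store) : SimpleGraph (Fin n) :=
  (graphOfCode (n, Q)).2

theorem storedGraph_adj {n : ℕ} {Q : Store} {x y : Fin n} :
    (storedGraph n Q).Adj x y ↔ codeAdj Q x y = true :=
  graphOfCode_adj

section Transfer

variable {n d K k : ℕ} {G : SimpleGraph (Fin n)} {D : Set ℕ} {Q : Store}

/-- The graph that is stored in the end is a subgraph of the given one. -/
theorem Invariant.storedGraph_le {N v : ℕ} {L : Set ℕ}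
    (h : Invariant n d N (valAdj G) D v L Q) : storedGraph n Q ≤ G := by
  intro x y hxy
  have hne := hxy.ne
  have hval : ∀ {x y : Fin n}, x ≠ y → ((x : ℕ), (y : ℕ)) ∈ Q → G.Adj x y := by
    intro x y hne hQ
    obtain ⟨_, _, hadj⟩ := (h.edge x y hQ fun e => hne (Fin.ext e)).1
    exact hadj
  rw [storedGraph_adj, codeAdj, Bool.and_eq_true, Bool.or_eq_true, decide_eq_true_eq,
    decide_eq_true_eq] at hxy
  exact hxy.2.elim (hval hne) fun h' => (hval hne.symm h').symm

/-- The stored graph has the same small minors. -/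
theorem Invariant.minorIn {W : Type*} [Finite W] [Nontrivial W] {F : SimpleGraph W}
    (hF : F.Connected) (hdeg : ∀ a, (F.neighborSet a).ncard ≤ d)
    (h : Invariant n d (threshold d K) (valAdj G) D n ∅ Q) (hD : ∀ a < n, a ∈ D)
    {C : Finset ℕ} (hC : ∀ a b, valAdj G a b → a ∈ C ∨ b ∈ C) (hCK : C.card ≤ K)
    {X : Finset (Fin n)} (hX : X.card < K) (hmin : MinorIn F G {v | v ∉ X}) :
    MinorIn F (storedGraph n Q) {v | v ∉ X} := by
  have hQadj : ∀ {x y : Fin n}, x ≠ y → ((x : ℕ), (y : ℕ)) ∈ Q →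
      (storedGraph n Q).Adj x y := by
    intro x y hne hQ
    rw [storedGraph_adj, codeAdj]
    simp [hQ, Fin.val_inj, hne]
  have hval : ∀ {x y : Fin n}, G.Adj x y → valAdj G x y := fun {x y} h => ⟨x.2, y.2, h⟩
  refine hmin.transfer (A := Finset.univ.filter fun a : Fin n => ((a : ℕ), (a : ℕ)) ∈ Q)
    (N := threshold d K) hF hdeg h.storedGraph_le ?_ ?_ ?_ ?_
  · intro u hu w hw hadj
    simp only [Finset.mem_filter, Finset.mem_univ, true_and] at hu hw
    exact hw (h.nbr u (hD u u.2) hu w (hval hadj))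
  · intro u hu w hw hadj
    simp only [Finset.mem_filter, Finset.mem_univ, true_and] at hu hw
    obtain h' | h' := h.matched u (hD u u.2) w (hD w w.2) hu hw (hval hadj)
    · exact hQadj hadj.ne h'
    · exact (hQadj hadj.ne' h').symm
  · have hA : (Finset.univ.filter fun a : Fin n => ((a : ℕ), (a : ℕ)) ∈ Q).card ≤ 2 * K := by
      refine le_trans ?_ (h.card_loops_le hC hCK)
      refine Finset.card_le_card_of_injOn Fin.val ?_ Fin.val_injective.injOn
      intro v hv
      rw [Finset.mem_coe, mem_loops]
      simpa using hv
    -- The threshold is made for this: `|X| < K` and `|A| * d ≤ 2 * K * d`.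
    have := Nat.mul_le_mul_right d hA
    unfold threshold
    calc _ < K + 2 * K * d := by omega
      _ = K + 2 * d * K := by ring
  · intro v hv S hS hSd hSadj
    simp only [Finset.mem_filter, Finset.mem_univ, true_and] at hv
    have hmap : ∀ {p : ℕ → Prop}, (∀ s ∈ S.map Fin.valEmbedding, p s) ↔ ∀ s ∈ S, p s := by
      simp
    refine (h.common v (hD v v.2) hv (S.map Fin.valEmbedding) (hS.map)
      (by simpa using hSd) (hmap.2 fun s hs => hval (hSadj s hs))).imp (fun h' s hs => ?_)
      fun h' => ?_
    · exact hQadj (hSadj s hs).ne (hmap.1 h' s hs)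
    · refine ⟨Finset.univ.filter fun u : Fin n =>
        (u : ℕ) ∈ commonSet n n Q (S.map Fin.valEmbedding), h'.trans ?_, fun u hu => ?_⟩
      · refine (Finset.card_le_card (t := (Finset.univ.filter fun u : Fin n =>
          (u : ℕ) ∈ commonSet n n Q (S.map Fin.valEmbedding)).image Fin.val) ?_).trans
          Finset.card_image_le
        intro u hu
        have hun : u < n := (mem_commonSet.1 hu).1
        exact Finset.mem_image.2 ⟨⟨u, hun⟩, by simpa using hu, rfl⟩
      · simp only [Finset.mem_filter, Finset.mem_univ, true_and] at hu ⊢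
        obtain ⟨-, ⟨-, h2⟩, h3⟩ := mem_commonSet.1 hu
        refine ⟨h2, fun s hs => ?_⟩
        have hus := hmap.1 h3 s hs
        refine hQadj ?_ hus
        rintro rfl
        exact h2 hus

end Transfer

end MinorStream

/-! ### Deterministic algorithms as a special case of randomized ones. -/

namespace StreamingAlgorithm

/-- The deterministic algorithm with the given initialization, update and output functions. -/
def deterministic (init : Params → List ℕ) (step : Params → List ℕ → ALToken → List ℕ)
    (output : Params → List ℕ → Bool) : StreamingAlgorithm where
  coins _ := 0
  init := init
  step p s t _ := step p s t
  output := output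

variable {init : Params → List ℕ} {step : Params → List ℕ → ALToken → List ℕ}
  {output : Params → List ℕ → Bool}

theorem isDeterministic_deterministic : (deterministic init step output).IsDeterministic :=
  fun _ => rfl

theorem isComputable_deterministic (hi : Computable init)
    (hs : Computable fun x : Params × List ℕ × ALToken => step x.1 x.2.1 x.2.2)
    (ho : Computable fun x : Params × List ℕ => output x.1 x.2) :
    (deterministic init step output).IsComputable := by
  have h : Computable fun x : Params × List ℕ × ALToken × ℕ => (x.1, x.2.1, x.2.2.1) :=
    Computable.fst.pair ((Computable.fst.comp Computable.snd).pair
      (Computable.fst.comp (Computable.snd.comp Computable.snd)))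
  have h' := hs.comp h
  have h0 : Computable fun _ : Params => 0 := Computable.const 0
  exact ⟨h0, hi, h', ho⟩

theorem memory_deterministic (p : Params) (σ : List ALToken)
    (r : (deterministic init step output).CoinSeq p σ.length) (i : ℕ) :
    (deterministic init step output).memory p σ r i = (σ.take i).foldl (step p) (init p) := by
  have h : σ.take i = ((List.finRange σ.length).take i).map σ.get := by
    rw [List.map_take, List.map_get_finRange]
  rw [h, List.foldl_map]
  rfl

/-- Every sequence of coin flips leads to the right answer, so the probability of success is `1`. -/
theorem solvesInAL_deterministic {P : ParamGraphProblem} {S : ℕ → ℕ → ℕ}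
    (h : ∀ (n k K : ℕ) (G : SimpleGraph (Fin n)), P.Promise n k K G →
      ∀ σ : List ALToken, IsALStream G σ →
        (∀ i, FitsInWords n (S n K) ((σ.take i).foldl (step (n, k, K)) (init (n, k, K)))) ∧
        (output (n, k, K) (σ.foldl (step (n, k, K)) (init (n, k, K))) = true ↔ P.Yes n k K G)) :
    (deterministic init step output).SolvesInAL P S := by
  intro n k K G hG σ hσ
  obtain ⟨h1, h2⟩ := h n k K G hG σ hσ
  refine ⟨fun r i _ => ?_, ?_⟩
  · rw [memory_deterministic]
    exact h1 i
  · have hall : ∀ r : (deterministic init step output).CoinSeq (n, k, K) σ.length,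
        (deterministic init step output).output (n, k, K)
          ((deterministic init step output).memory (n, k, K) σ r σ.length) = true ↔
          P.Yes n k K G := by
      intro r
      rw [memory_deterministic, List.take_length]
      exact h2
    rw [Nat.card_congr (Equiv.subtypeUnivEquiv hall), div_self]
    · norm_num
    · have : 0 < Nat.card ((deterministic init step output).CoinSeq (n, k, K) σ.length) :=
        Nat.card_pos
      positivity

/-- The algorithm that ignores the stream. -/
theorem exists_memoryless {P : ParamGraphProblem} (S : ℕ → ℕ → ℕ) (answer : Params → Bool)
    (hc : Computable answer)
    (h : ∀ (n k K : ℕ) (G : SimpleGraph (Fin n)), answer (n, k, K) = true ↔ P.Yes n k K G) :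
    ∃ A : StreamingAlgorithm, A.IsDeterministic ∧ A.IsComputable ∧ A.SolvesInAL P S := by
  refine ⟨deterministic (fun _ => []) (fun _ _ _ => []) fun p _ => answer p,
    isDeterministic_deterministic, isComputable_deterministic (Computable.const _)
      (Computable.const _) (hc.comp Computable.fst), solvesInAL_deterministic ?_⟩
  intro n k K G _ σ _
  refine ⟨fun i => ?_, h n k K G⟩
  have : ∀ l : List ALToken, l.foldl (fun _ _ => ([] : List ℕ)) [] = [] := by
    intro l
    induction l with
    | nil => rfl
    | cons t l ih => exact ih
  rw [this]
  simp [FitsInWords]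

end StreamingAlgorithm

/-! ### Assembly of the algorithm and the exceptional families. -/

namespace MinorStream

open SimpleGraph StreamingAlgorithm

theorem ncard_neighborSet_le {𝓕 : Set FinGraph} {d : ℕ} (hd : familyMaxDegree 𝓕 = (d : ℕ∞))
    {F : FinGraph} (hF : F ∈ 𝓕) (a : Fin F.1) : (F.2.neighborSet a).ncard ≤ d := by
  classical
  have h1 : ((F.2.maxDegree : ℕ) : ℕ∞) ≤ d := by
    rw [← hd, familyMaxDegree]
    refine le_trans (le_of_eq ?_) (le_iSup₂ (f := fun (F : FinGraph) (_ : F ∈ 𝓕) =>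
      ((@SimpleGraph.maxDegree _ F.2 _ fun _ _ => Classical.propDecidable _ : ℕ) : ℕ∞)) F hF)
    congr!
  have h2 : F.2.maxDegree ≤ d := by exact_mod_cast h1
  refine le_trans ?_ ((F.2.degree_le_maxDegree a).trans h2)
  rw [Set.ncard_eq_toFinset_card', Set.toFinset_card, card_neighborSet_eq_degree]

/-- The initial memory. -/
def initMemory : List ℕ :=
  encodeState (0, [])

/-- One step of the algorithm, on the level of the memory. -/
def stepMemory (d : ℕ) (p : Params) (s : List ℕ) (t : ALToken) : List ℕ :=
  encodeState (stepStore p.1 d (threshold d p.2.2) (decodeState s) t)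

/-- The answer of the algorithm. -/
def answer (d : ℕ) (inFamily : ℕ × Store → Bool) (p : Params) (s : List ℕ) : Bool :=
  decide (p.2.2 ≤ p.2.1) ||
    (minorLists p.1 p.2.1 (finalize p.1 d (threshold d p.2.2) (decodeState s).1
      (decodeState s).2)).any fun cs => cs.all fun c => !inFamily c

theorem primrec_threshold (d : ℕ) : Primrec (threshold d) :=
  Primrec.nat_add.comp Primrec.id (Primrec.nat_mul.comp (Primrec.const (2 * d)) Primrec.id)

theorem computable_stepMemory (d : ℕ) :
    Computable fun x : Params × List ℕ × ALToken => stepMemory d x.1 x.2.1 x.2.2 := by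
  refine (primrec_encodeState.comp (primrec_stepStore (Primrec.fst.comp Primrec.fst)
    (Primrec.const d) ((primrec_threshold d).comp ?_)
    (primrec_decodeState.comp (Primrec.fst.comp Primrec.snd))
    (Primrec.snd.comp Primrec.snd))).to_comp
  exact Primrec.snd.comp (Primrec.snd.comp Primrec.fst)

theorem computable_answer (d : ℕ) {inFamily : ℕ × Store → Bool} (h : Computable inFamily) :
    Computable fun x : Params × List ℕ => answer d inFamily x.1 x.2 := by
  have hK : Primrec fun x : Params × List ℕ => x.1.2.2 :=
    Primrec.snd.comp (Primrec.snd.comp Primrec.fst)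
  have hk : Primrec fun x : Params × List ℕ => x.1.2.1 :=
    Primrec.fst.comp (Primrec.snd.comp Primrec.fst)
  have hn : Primrec fun x : Params × List ℕ => x.1.1 := Primrec.fst.comp Primrec.fst
  have hs : Primrec fun x : Params × List ℕ => decodeState x.2 :=
    primrec_decodeState.comp Primrec.snd
  refine Primrec.or.to_comp.comp (PrimrecPred.decide (Primrec.nat_le.comp hK hk)).to_comp ?_
  refine (Computable.list_any (Computable.list_all (Primrec.not.to_comp.comp h))).comp ?_
  exact (primrec_minorLists hn hk (primrec_finalize hn (Primrec.const d)
    ((primrec_threshold d).comp hK) (Primrec.fst.comp hs) (Primrec.snd.comp hs))).to_comp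

theorem foldl_stepMemory (d n k K : ℕ) (l : List ALToken) (s : ℕ × Store) :
    l.foldl (stepMemory d (n, k, K)) (encodeState s) =
      encodeState (l.foldl (stepStore n d (threshold d K)) s) := by
  induction l generalizing s with
  | nil => rfl
  | cons t l ih =>
    rw [List.foldl_cons, List.foldl_cons, ← ih, stepMemory, decodeState_encodeState]

theorem valAdj_iff {n : ℕ} {G : SimpleGraph (Fin n)} {v : Fin n} {w : ℕ} :
    valAdj G v w ↔ ∃ x : Fin n, (x : ℕ) = w ∧ G.Adj v x := by
  constructor
  · rintro ⟨_, hw, h⟩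
    exact ⟨⟨w, hw⟩, rfl, h⟩
  · rintro ⟨x, rfl, h⟩
    exact ⟨v.2, x.2, h⟩

/-- The states of the algorithm on an adjacency list stream. -/
theorem run_stream {n : ℕ} {G : SimpleGraph (Fin n)} {σ : List ALToken} (hσ : IsALStream G σ)
    (d N : ℕ) :
    (∀ i, GoodState n d N (valAdj G) ((σ.take i).foldl (stepStore n d N) (0, []))) ∧
      ∃ D : Set ℕ, (∀ a < n, a ∈ D) ∧ Invariant n d N (valAdj G) D n ∅
        (finalize n d N (σ.foldl (stepStore n d N) (0, [])).1
          (σ.foldl (stepStore n d N) (0, [])).2) := by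
  obtain ⟨order, nbr, ho, hall, hnbr, rfl⟩ := hσ
  let nbr' : ℕ → List ℕ := fun a => if h : a < n then (nbr ⟨a, h⟩).map Fin.val else []
  have hnbr' : ∀ v : Fin n, nbr' v = (nbr v).map Fin.val := fun v => by
    simp [nbr']
  have hσ : (order.flatMap fun v : Fin n =>
      (Sum.inl (v : ℕ) : ALToken) :: (nbr v).map fun w : Fin n => Sum.inr ((v : ℕ), (w : ℕ))) =
      (order.map Fin.val).flatMap fun v =>
        (Sum.inl v : ALToken) :: (nbr' v).map fun w => (Sum.inr (v, w) : ALToken) := by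
    rw [List.flatMap_map]
    congr 1
    funext v
    rw [hnbr', List.map_map]
    rfl
  have h := foldl_blocks (n := n) (d := d) (N := N) (R := valAdj G) (D := ∅)
    (fun a b ⟨ha, hb, _⟩ => ⟨ha, hb⟩) (fun a b ⟨ha, hb, hadj⟩ => ⟨hb, ha, hadj.symm⟩)
    (fun a ⟨_, _, hadj⟩ => hadj.ne rfl) nbr' (order.map Fin.val)
    (ho.map Fin.val_injective) (by
      intro v hv
      obtain ⟨v, -, rfl⟩ := List.mem_map.1 hv
      rw [hnbr']
      refine ⟨v.2, (hnbr v).1.map Fin.val_injective, fun w => ?_⟩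
      rw [valAdj_iff, List.mem_map]
      exact exists_congr fun x => by rw [(hnbr v).2, and_comm])
    -- The initial current vertex `0` is a dummy; cleaning up the empty store after it has no
    -- effect.
    (by simp) (s := (0, [])) ⟨Nat.zero_le n, ∅, ∅, Invariant.nil _ _ _ _ _⟩
    (fun v' _ => Invariant.nil _ _ _ _ _)
  rw [hσ]
  -- After the stream the fictitious vertex `n` is current, so `commonSet` no longer excludes any
  -- vertex of the graph.
  refine ⟨fun i => h.1.take i, _, fun a ha => ?_, h.2 n ?_⟩
  · exact Or.inr (List.mem_map.2 ⟨⟨a, ha⟩, hall _, rfl⟩)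
  · rintro (hn | hn)
    · exact hn
    · obtain ⟨v, -, hv⟩ := List.mem_map.1 hn
      exact v.2.ne hv

theorem exists_vertexCover {n K : ℕ} {G : SimpleGraph (Fin n)}
    (h : G.vertexCoverNum ≤ (K : ℕ∞)) :
    ∃ C : Finset (Fin n), C.card ≤ K ∧ ∀ a b, G.Adj a b → a ∈ C ∨ b ∈ C := by
  classical
  obtain ⟨s, hs, hc⟩ := vertexCoverNum_exists G
  refine ⟨s.toFinset, ?_, fun a b hab => by simpa using hc hab⟩
  rw [← hs, Set.encard_eq_coe_toFinset_card] at h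
  exact_mod_cast h

/-- The algorithm is correct and obeys the space bound. -/
theorem solvesInAL {𝓕 : Set FinGraph} {d : ℕ} (hd : familyMaxDegree 𝓕 = (d : ℕ∞))
    (hconn : ∀ F ∈ 𝓕, F.2.Connected) (hnt : ∀ F ∈ 𝓕, Nontrivial (Fin F.1)) (hd1 : 1 ≤ d)
    {inFamily : ℕ × Store → Bool} (hfam : ∀ c, inFamily c = true ↔ graphOfCode c ∈ 𝓕) :
    (deterministic (fun _ => initMemory) (stepMemory d) (answer d inFamily)).SolvesInAL
      (minorDeletion 𝓕) (fun _ K => 499 * (d * K ^ (d + 1))) := by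
  refine solvesInAL_deterministic fun n k K G hG σ hσ => ?_
  obtain ⟨hvc, hdK⟩ := hG
  rw [hd] at hdK
  have hK : 1 ≤ K := hd1.trans (by exact_mod_cast hdK)
  obtain ⟨C, hCK, hC⟩ := exists_vertexCover hvc
  obtain ⟨hgood, D, hD, hfin⟩ := run_stream hσ d (threshold d K)
  have hC' : ∀ a b, valAdj G a b → a ∈ C.map Fin.valEmbedding ∨ b ∈ C.map Fin.valEmbedding := by
    rintro a b ⟨ha, hb, hab⟩
    refine (hC _ _ hab).imp (fun h => ?_) fun h => ?_
    · exact Finset.mem_map.2 ⟨_, h, rfl⟩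
    · exact Finset.mem_map.2 ⟨_, h, rfl⟩
  have hCK' : (C.map Fin.valEmbedding).card ≤ K := by rwa [Finset.card_map]
  have hlt : ∀ a b, valAdj G a b → a < n ∧ b < n := fun a b ⟨ha, hb, _⟩ => ⟨ha, hb⟩
  unfold initMemory
  refine ⟨fun i => ?_, ?_⟩
  · rw [foldl_stepMemory]
    obtain ⟨hv, D', L, hinv⟩ := hgood i
    refine ⟨hinv.length_encodeState_le hC' hCK' hd1 hK, fun x hx => ?_⟩
    -- The current vertex is only known to be at most `n` (the dummy `0` when `n = 0`), but `n`
    -- itself fits into a word.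
    have hn : n < 2 ^ (Nat.log 2 n + 1) := Nat.lt_pow_succ_log_self (by norm_num) n
    obtain rfl | hx := hinv.lt_of_mem_encodeState hlt hx
    · exact lt_of_le_of_lt hv hn
    · exact hx.trans hn
  · rw [foldl_stepMemory]
    unfold answer
    rw [decodeState_encodeState, Bool.or_eq_true, decide_eq_true_eq, any_minorLists_iff hfam]
    have hyes : (minorDeletion 𝓕).Yes n k K G ↔ ∃ X : Finset (Fin n), X.card ≤ k ∧
        ∀ F ∈ 𝓕, ¬ MinorIn F.2 G {v | v ∉ X} :=
      exists_congr fun X => and_congr Iff.rfl (forall₂_congr fun F _ => not_congr isMinor_induce_iff)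
    rw [hyes]
    by_cases hkK : K ≤ k
    -- Deleting the cover `C` leaves no edge, whereas a connected nontrivial `F` needs one.
    · refine iff_of_true (Or.inl hkK) ⟨C, hCK.trans hkK, fun F hF hmin => ?_⟩
      have := hnt F hF
      obtain ⟨H, hH, hX, hmin⟩ := hmin.restrict
      obtain ⟨B, hB, hc, -, -⟩ := hmin.support (hconn F hF)
      obtain ⟨a⟩ := (hconn F hF).nonempty
      obtain ⟨x, hx⟩ := Set.nonempty_coe_sort.1 (hc a).nonempty
      obtain ⟨y, hxy⟩ := hB a hx
      exact (hC x y (hH hxy)).elim (hX ⟨y, hxy⟩) (hX ⟨x, hxy.symm⟩)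
    · rw [or_iff_right hkK]
      refine exists_congr fun X => and_congr_right fun hXk => forall₂_congr fun F hF =>
        not_congr ⟨fun hmin => hmin.mono hfin.storedGraph_le le_rfl, fun hmin => ?_⟩
      have := hnt F hF
      exact hfin.minorIn (hconn F hF) (ncard_neighborSet_le hd hF) hD hC' hCK'
        (lt_of_le_of_lt hXk (not_le.1 hkK)) hmin

theorem exists_algorithm {𝓕 : Set FinGraph} {d : ℕ} (hd : familyMaxDegree 𝓕 = (d : ℕ∞))
    (hconn : ∀ F ∈ 𝓕, F.2.Connected) (hnt : ∀ F ∈ 𝓕, Nontrivial (Fin F.1)) (hne : 𝓕.Nonempty) :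
    ∃ A : StreamingAlgorithm,
      A.IsDeterministic ∧ (FamilyDecidable 𝓕 → A.IsComputable) ∧
      A.SolvesInAL (minorDeletion 𝓕) (fun _ K => 499 * (d * K ^ (d + 1))) := by
  classical
  have hd1 : 1 ≤ d := by
    obtain ⟨F, hF⟩ := hne
    have := hnt F hF
    obtain ⟨a⟩ := (hconn F hF).nonempty
    obtain ⟨b, hab⟩ := (hconn F hF).preconnected.exists_adj_of_nontrivial a
    refine le_trans ?_ (ncard_neighborSet_le hd hF a)
    exact (Set.ncard_pos (Set.toFinite _)).2 ⟨b, hab⟩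
  refine ⟨deterministic (fun _ => initMemory) (stepMemory d)
    (answer d fun c => decide (graphOfCode c ∈ 𝓕)), isDeterministic_deterministic, fun hdec => ?_,
    solvesInAL hd hconn hnt hd1 fun c => decide_eq_true_iff⟩
  obtain ⟨inst, hcomp⟩ := hdec
  refine isComputable_deterministic (Computable.const _) (computable_stepMemory d)
    (computable_answer d (hcomp.of_eq fun c => ?_))
  congr!

end MinorStream

-- The one-vertex graph is a minor of every nonempty graph, so all vertices must be deleted and the
-- answer is whether `n ≤ k`. No memory is used, so any bound `S` is met, even the bound zero that
-- arises for `d = 0`.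
open SimpleGraph StreamingAlgorithm MinorStream in
theorem exists_algorithm_of_single {𝓕 : Set FinGraph} (hconn : ∀ F ∈ 𝓕, F.2.Connected)
    {F : FinGraph} (hF : F ∈ 𝓕) (hs : Subsingleton (Fin F.1)) (S : ℕ → ℕ → ℕ) :
    ∃ A : StreamingAlgorithm,
      A.IsDeterministic ∧ A.IsComputable ∧ A.SolvesInAL (minorDeletion 𝓕) S := by
  refine exists_memoryless S (fun p => decide (p.1 ≤ p.2.1))
    (PrimrecPred.decide (Primrec.nat_le.comp Primrec.fst
      (Primrec.fst.comp Primrec.snd))).to_comp fun n k K G => ?_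
  rw [decide_eq_true_eq]
  constructor
  · intro hnk
    refine ⟨Finset.univ, by simpa using hnk, fun F' hF' hmin => ?_⟩
    obtain ⟨B, hc, -, -⟩ := hmin
    obtain ⟨a⟩ := (hconn F' hF').nonempty
    obtain ⟨⟨⟨v, hv⟩, -⟩⟩ := (hc a).nonempty
    exact hv (Finset.mem_univ v)
  · rintro ⟨X, hX, hno⟩
    by_contra hnk
    obtain ⟨v, hv⟩ : ∃ v : Fin n, v ∉ X := by
      by_contra! hall
      rw [Finset.eq_univ_of_forall hall, Finset.card_univ, Fintype.card_fin] at hX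
      exact hnk hX
    refine hno F hF (isMinor_induce_iff.2 ⟨fun _ => {v}, ?_, ?_, ?_, ?_⟩)
    · rintro _ _ rfl
      exact hv
    · exact fun _ => (connected_iff _).2 ⟨Preconnected.of_subsingleton, ⟨⟨v, rfl⟩⟩⟩
    · exact fun a b hab => absurd (Subsingleton.elim a b) hab
    · exact fun a b hab => absurd (Subsingleton.elim a b) hab.ne

theorem mainTheorem2 :
    ∃ C : ℕ, ∀ (𝓕 : Set FinGraph) (d : ℕ),
      (∀ F ∈ 𝓕, F.2.Connected) → familyMaxDegree 𝓕 = (d : ℕ∞) →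
      ∃ A : StreamingAlgorithm,
        A.IsDeterministic ∧
        (FamilyDecidable 𝓕 → A.IsComputable) ∧
        A.SolvesInAL (minorDeletion 𝓕) (fun _ K => C * (d * K ^ (d + 1))) := by
  refine ⟨499, fun 𝓕 d hconn hd => ?_⟩
  obtain rfl | hne := 𝓕.eq_empty_or_nonempty
  · obtain ⟨A, h1, h2, h3⟩ := StreamingAlgorithm.exists_memoryless (P := minorDeletion ∅)
      (fun _ K => 499 * (d * K ^ (d + 1))) (fun _ => true) (Computable.const true)
      fun n k K G => iff_of_true rfl ⟨∅, Nat.zero_le k, fun F hF => absurd hF (by simp)⟩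
    exact ⟨A, h1, fun _ => h2, h3⟩
  by_cases hs : ∃ F ∈ 𝓕, Subsingleton (Fin F.1)
  · obtain ⟨F, hF, hs⟩ := hs
    obtain ⟨A, h1, h2, h3⟩ := exists_algorithm_of_single hconn hF hs
      (fun _ K => 499 * (d * K ^ (d + 1)))
    exact ⟨A, h1, fun _ => h2, h3⟩
  · push Not at hs
    exact MinorStream.exists_algorithm hd hconn hs hne
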